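/- Let $n\ge 1$ and let $\mathbb S^n\subset\mathbb R^{n+1}$ be the unit sphere with its standard round metric, $\Delta=-\operatorname{div}\circ\operatorname{grad}$ its Laplace--Beltrami operator and $\operatorname{Vol}$ its Riemannian volume. A nodal domain of a (smooth, not identically zero) eigenfunction $\varphi$ of $\Delta$ is a connected component of $\{\varphi\neq 0\}$. There is a constant $C=C(n)>0$, depending only on $n$, such that for every eigenvalue $\lambda$ of $\Delta$ and every $R>0$ with $R<1/\sqrt\lambda$ there exist an eigenfunction $\varphi$ with $\Delta\varphi=\lambda\varphi$, a nodal domain $A$ of $\varphi$, and a geodesic ball $B\subset\mathbb S^n$ of radius $R$ such that $$A\cap \tfrac12 B\neq\emptyset\qquad\text{and}\qquad \frac{\operatorname{Vol}(A\cap B)}{\operatorname{Vol}(B)}\le\frac{C}{(\sqrt\lambda)^{n-1}},$$ where $\tfrac12 B$ is the ball of radius $R/2$ concentric with $B$. (For $\lambda=0$ the condition $R<1/\sqrt\lambda$ is read as no restriction on $R$, and the right-hand side as $+\infty$ if $n\ge2$ and as $C$ if $n=1$.) -/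

import Mathlib

open MeasureTheory Metric
open scoped Manifold ContDiff

noncomputable section

namespace RoundSphere

/-- The ambient Euclidean space `ℝⁿ⁺¹`. -/
abbrev Ambient (n : ℕ) : Type := EuclideanSpace ℝ (Fin (n + 1))

/-- The unit sphere `Sⁿ ⊆ ℝⁿ⁺¹`. -/
abbrev Sph (n : ℕ) : Type := Metric.sphere (0 : Ambient n) 1

instance factFinrankAmbient (n : ℕ) : Fact (Module.finrank ℝ (Ambient n) = n + 1) :=
  ⟨finrank_euclideanSpace_fin⟩

/-- The extension `x ↦ f (x / ‖x‖)` of a map on `Sⁿ` to `ℝⁿ⁺¹ ∖ {0}`, constant along rays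
(with value `0` at the origin, which plays no role). -/
def radialExt {n : ℕ} {F : Type*} [Zero F] (f : Sph n → F) (x : Ambient n) : F :=
  open Classical in
  if h : x ≠ 0 then
    f ⟨‖x‖⁻¹ • x, by
      rw [mem_sphere_zero_iff_norm, norm_smul, norm_inv, norm_norm,
        inv_mul_cancel₀ (norm_ne_zero_iff.mpr h)]⟩
  else 0

/-- The Riemannian gradient of a function on the round sphere, as a vector of `ℝⁿ⁺¹`.
Since the extension is constant along rays, its Euclidean gradient at a point `p` of the sphere
is tangent to the sphere at `p`. -/
def grad {n : ℕ} (f : Sph n → ℝ) (p : Sph n) : Ambient n :=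
  gradient (radialExt f) (p : Ambient n)

/-- The Riemannian divergence of a tangent vector field on the round sphere. The Levi-Civita
connection of the sphere is the tangential part of the Euclidean derivative, so the divergence at
`p` is the sum of `⟪D_e X, e⟫` over an orthonormal basis `e` of the tangent space at `p`; the
extension of `X` has derivative zero in the normal direction `p`, so this sum is the full trace. -/
def div {n : ℕ} (X : Sph n → Ambient n) (p : Sph n) : ℝ :=
  LinearMap.trace ℝ (Ambient n)
    (fderiv ℝ (radialExt X) (p : Ambient n) : Ambient n →ₗ[ℝ] Ambient n)

/-- The Laplace–Beltrami operator `Δ = - div ∘ grad` of the round sphere. -/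
def laplaceBeltrami {n : ℕ} (f : Sph n → ℝ) (p : Sph n) : ℝ :=
  - div (grad f) p

/-- `φ` is an eigenfunction of the Laplace–Beltrami operator with eigenvalue `lam`: smooth, not
identically zero, and `Δ φ = lam φ`. -/
structure IsEigenfunction (n : ℕ) (lam : ℝ) (φ : Sph n → ℝ) : Prop where
  smooth : ContMDiff (𝓡 n) 𝓘(ℝ, ℝ) ∞ φ
  ne_zero : φ ≠ 0
  eigen : ∀ p, laplaceBeltrami φ p = lam * φ p

/-- `lam` is an eigenvalue of the Laplace–Beltrami operator of `Sⁿ`. -/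
def IsEigenvalue (n : ℕ) (lam : ℝ) : Prop :=
  ∃ φ : Sph n → ℝ, IsEigenfunction n lam φ

/-- `A` is a nodal domain of `φ`: a connected component of `{φ ≠ 0}`. -/
def IsNodalDomain {n : ℕ} (φ : Sph n → ℝ) (A : Set (Sph n)) : Prop :=
  ∃ x, φ x ≠ 0 ∧ A = connectedComponentIn {y | φ y ≠ 0} x

/-- The open metric ball of radius `R` about `p` for the Riemannian (great circle) distance
of the round sphere, the distance of two points being the angle between them. -/
def geodesicBall {n : ℕ} (p : Sph n) (R : ℝ) : Set (Sph n) :=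
  {x | InnerProductGeometry.angle (p : Ambient n) (x : Ambient n) < R}

/-- The Riemannian volume (surface measure) of the round sphere. -/
def vol (n : ℕ) : Measure (Sph n) :=
  (volume : Measure (Ambient n)).toSphere

end RoundSphere

/-!
The spectrum of `Sⁿ` is `{k (k + n - 1)}`: a homogeneous polynomial `P` of degree `k` satisfies
`Δ P = k (k + n - 1) P - L P` on the sphere, where `L` is the Euclidean Laplacian, so an
eigenfunction for any other value is, by induction on the degree and self-adjointness of `Δ`,
orthogonal to all polynomials; these are dense. Self-adjointness follows from the divergence
theorem, which integration in polar coordinates reduces to the vanishing of the integral of a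
Euclidean divergence with compact support.

For large `k` the eigenfunction is the zonal harmonic about the first axis of the coordinate
hyperplane orthogonal to the last axis, extended constantly along the last axis. It equals
`x₀ ^ k q(t)`, where `t` is the squared slope of the transverse coordinates with respect to `x₀`,
and `q` solves a hypergeometric equation. Sturm comparison with the supersolution `(T - t) ^ 2`
gives `q` a root `t ≤ T`, with `T` of order `k⁻²`. Hence the nodal domain containing the positive
`x₀`-axis lies in a sector of opening of order `1 / k`, which comes arbitrarily close to the pole of
the last axis. A geodesic ball about that pole, of any radius, meets the sector in a proportion of
order `k ^ (1 - n)`. For bounded `k`, and for `n = 1`, any nodal domain will do.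
-/

noncomputable section

namespace RoundSphere

section InnerProductSpace

variable {E : Type*} [NormedAddCommGroup E] [InnerProductSpace ℝ E]

theorem hasFDerivAt_norm_of_norm_eq_one {p : E} (hp : ‖p‖ = 1) :
    HasFDerivAt (fun x : E => ‖x‖) (innerSL ℝ p) p := by
  have h := (hasStrictFDerivAt_norm_sq p).hasFDerivAt.sqrt (by simp [hp])
  simp only [Real.sqrt_sq (norm_nonneg _), hp] at h
  refine h.congr_fderiv ?_
  ext v
  simp

theorem hasFDerivAt_norm_inv_smul_of_norm_eq_one {p : E} (hp : ‖p‖ = 1) :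
    HasFDerivAt (fun x : E => ‖x‖⁻¹ • x)
      (ContinuousLinearMap.id ℝ E - (innerSL ℝ p).smulRight p) p := by
  have hinv := (hasDerivAt_inv (x := ‖p‖) (by simp [hp])).comp_hasFDerivAt p
    (hasFDerivAt_norm_of_norm_eq_one hp)
  refine (hinv.smul (hasFDerivAt_id p)).congr_fderiv ?_
  ext1 v
  simp [hp, sub_eq_add_neg]

theorem contDiffAt_norm_inv_smul {k : WithTop ℕ∞} {x : E} (hx : x ≠ 0) :
    ContDiffAt ℝ k (fun y : E => ‖y‖⁻¹ • y) x :=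
  ((contDiffAt_norm ℝ hx).inv (norm_ne_zero_iff.mpr hx)).smul contDiffAt_id

theorem toLinearMap_smulRight {F : Type*} [NormedAddCommGroup F] [NormedSpace ℝ F]
    (f : E →L[ℝ] ℝ) (x : F) :
    ((f.smulRight x : E →L[ℝ] F) : E →ₗ[ℝ] F) = (f : E →ₗ[ℝ] ℝ).smulRight x := rfl

theorem trace_comp_id_sub_inner_smulRight [FiniteDimensional ℝ E] (L : E →L[ℝ] E) (p : E) :
    LinearMap.trace ℝ E
        (L ∘L (ContinuousLinearMap.id ℝ E - (innerSL ℝ p).smulRight p) : E →L[ℝ] E) =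
      LinearMap.trace ℝ E (L : E →ₗ[ℝ] E) - inner ℝ p (L p) := by
  have hcomp : L ∘L (ContinuousLinearMap.id ℝ E - (innerSL ℝ p).smulRight p) =
      L - (innerSL ℝ p).smulRight (L p) := by
    ext v
    simp
  rw [hcomp, ContinuousLinearMap.toLinearMap_sub, map_sub, toLinearMap_smulRight,
    LinearMap.trace_smulRight]
  simp

end InnerProductSpace

section RadialExtension

variable {n : ℕ} {F : Type*}

theorem coe_ne_zero (p : Sph n) : (p : Ambient n) ≠ 0 := ne_zero_of_mem_unit_sphere p

theorem norm_coe (p : Sph n) : ‖(p : Ambient n)‖ = 1 := mem_sphere_zero_iff_norm.mp p.2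

/-- The radial projection of a nonzero vector to the sphere. -/
def proj (x : Ambient n) (hx : x ≠ 0) : Sph n :=
  ⟨‖x‖⁻¹ • x, by
    rw [mem_sphere_zero_iff_norm, norm_smul, norm_inv, norm_norm,
      inv_mul_cancel₀ (norm_ne_zero_iff.mpr hx)]⟩

theorem coe_proj (x : Ambient n) (hx : x ≠ 0) : (proj x hx : Ambient n) = ‖x‖⁻¹ • x := rfl

theorem norm_smul_proj (x : Ambient n) (hx : x ≠ 0) : ‖x‖ • (proj x hx : Ambient n) = x := by
  rw [coe_proj, smul_inv_smul₀ (norm_ne_zero_iff.mpr hx)]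

theorem radialExt_of_ne_zero [Zero F] (f : Sph n → F) {x : Ambient n} (hx : x ≠ 0) :
    radialExt f x = f (proj x hx) :=
  dif_pos hx

theorem radialExt_coe [Zero F] (f : Sph n → F) (p : Sph n) : radialExt f p = f p := by
  rw [radialExt_of_ne_zero f (coe_ne_zero p)]
  congr 1
  ext1
  simp [coe_proj]

theorem radialExt_smul [Zero F] (f : Sph n → F) {c : ℝ} (hc : 0 < c) (x : Ambient n) :
    radialExt f (c • x) = radialExt f x := by
  by_cases hx : x = 0
  · simp [hx]
  rw [radialExt_of_ne_zero f hx, radialExt_of_ne_zero f (smul_ne_zero hc.ne' hx)]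
  congr 1
  ext1
  rw [coe_proj, coe_proj, norm_smul, Real.norm_of_nonneg hc.le, smul_smul]
  congr 1
  field_simp

theorem radialExt_map₂ {F₁ F₂ : Type*} [Zero F] [Zero F₁] [Zero F₂] {op : F₁ → F₂ → F}
    (h0 : op 0 0 = 0) (f : Sph n → F₁) (g : Sph n → F₂) :
    radialExt (fun p => op (f p) (g p)) = fun x => op (radialExt f x) (radialExt g x) := by
  funext x
  by_cases hx : x = 0
  · simp [radialExt, hx, h0]
  · simp only [radialExt_of_ne_zero _ hx]

theorem radialExt_restrict_eventuallyEq [Zero F] (G : Ambient n → F) {x : Ambient n}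
    (hx : x ≠ 0) :
    radialExt (fun q : Sph n => G q) =ᶠ[nhds x] fun y => G (‖y‖⁻¹ • y) := by
  filter_upwards [isOpen_ne.mem_nhds hx] with y hy
  rw [radialExt_of_ne_zero _ hy, coe_proj]

variable [NormedAddCommGroup F] [NormedSpace ℝ F]

theorem hasFDerivAt_radialExt_restrict {G : Ambient n → F} {p : Sph n} {L : Ambient n →L[ℝ] F}
    (hG : HasFDerivAt G L (p : Ambient n)) :
    HasFDerivAt (radialExt fun q : Sph n => G q)
      (L ∘L (ContinuousLinearMap.id ℝ (Ambient n) -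
        (innerSL ℝ (p : Ambient n)).smulRight (p : Ambient n))) (p : Ambient n) := by
  have hpp : ‖(p : Ambient n)‖⁻¹ • (p : Ambient n) = p := by simp
  rw [← hpp] at hG
  exact (HasFDerivAt.comp (f := fun x : Ambient n => ‖x‖⁻¹ • x) (p : Ambient n) hG
    (hasFDerivAt_norm_inv_smul_of_norm_eq_one (norm_coe p))).congr_of_eventuallyEq
      (radialExt_restrict_eventuallyEq G (coe_ne_zero p))

theorem fderiv_radialExt_smul (f : Sph n → F) {c : ℝ} (hc : 0 < c) (x : Ambient n) :
    fderiv ℝ (radialExt f) x = c • fderiv ℝ (radialExt f) (c • x) := by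
  have h : radialExt f = fun y => radialExt f (c • y) := by
    funext y
    rw [radialExt_smul f hc]
  conv_lhs => rw [h]
  rw [fderiv_comp_smul]

theorem fderiv_radialExt_self {f : Sph n → F} {x : Ambient n}
    (hf : DifferentiableAt ℝ (radialExt f) x) : fderiv ℝ (radialExt f) x x = 0 := by
  have hray : HasDerivAt (fun t : ℝ => t • x) x 1 := by
    simpa using (hasDerivAt_id (1 : ℝ)).smul_const x
  have hcomp : HasDerivAt (radialExt f ∘ fun t : ℝ => t • x) (fderiv ℝ (radialExt f) x x) 1 :=
    HasFDerivAt.comp_hasDerivAt (1 : ℝ) (by simpa using hf.hasFDerivAt) hray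
  have hconst : (radialExt f ∘ fun t : ℝ => t • x) =ᶠ[nhds 1] fun _ => radialExt f x := by
    filter_upwards [lt_mem_nhds (zero_lt_one' ℝ)] with t ht
    exact radialExt_smul f ht x
  exact (hcomp.congr_of_eventuallyEq hconst.symm).unique (hasDerivAt_const _ _)

end RadialExtension

section Calculus

variable {n : ℕ}

theorem grad_restrict {G : Ambient n → ℝ} {p : Sph n} {N : Ambient n}
    (hG : HasGradientAt G N (p : Ambient n)) :
    grad (fun q : Sph n => G q) p = N - inner ℝ N (p : Ambient n) • (p : Ambient n) := by
  refine HasGradientAt.gradient ?_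
  rw [hasGradientAt_iff_hasFDerivAt]
  refine (hasFDerivAt_radialExt_restrict hG.hasFDerivAt).congr_fderiv ?_
  ext1 v
  simp
  ring

theorem div_restrict {X : Ambient n → Ambient n} {p : Sph n} {L : Ambient n →L[ℝ] Ambient n}
    (hX : HasFDerivAt X L (p : Ambient n)) :
    div (fun q : Sph n => X q) p =
      LinearMap.trace ℝ (Ambient n) (L : Ambient n →ₗ[ℝ] Ambient n) -
        inner ℝ (p : Ambient n) (L p) := by
  rw [div, (hasFDerivAt_radialExt_restrict hX).fderiv, trace_comp_id_sub_inner_smulRight]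

theorem laplaceBeltrami_restrict {G : Ambient n → ℝ} {N : Ambient n → Ambient n}
    (hG : ∀ q : Sph n, HasGradientAt G (N q) (q : Ambient n)) {p : Sph n}
    {L : Ambient n →L[ℝ] Ambient n} (hN : HasFDerivAt N L (p : Ambient n)) :
    laplaceBeltrami (fun q : Sph n => G q) p =
      inner ℝ (p : Ambient n) (L p) + n * inner ℝ (N p) (p : Ambient n) -
      LinearMap.trace ℝ (Ambient n) (L : Ambient n →ₗ[ℝ] Ambient n) := by
  have hgrad : grad (fun q : Sph n => G q) =
      fun q : Sph n => (fun x => N x - inner ℝ (N x) x • x) (q : Ambient n) :=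
    funext fun q => grad_restrict (hG q)
  have hinner : HasFDerivAt (fun x => inner ℝ (N x) x) _ (p : Ambient n) :=
    hN.inner ℝ (hasFDerivAt_id (p : Ambient n))
  have htangential : HasFDerivAt (fun x => N x - inner ℝ (N x) x • x) _ (p : Ambient n) :=
    hN.fun_sub (hinner.fun_smul (hasFDerivAt_id (p : Ambient n)))
  rw [laplaceBeltrami, hgrad, div_restrict htangential]
  simp only [ContinuousLinearMap.toLinearMap_sub, ContinuousLinearMap.toLinearMap_add,
    ContinuousLinearMap.toLinearMap_smul, map_sub, map_add, map_smul,
    toLinearMap_smulRight, LinearMap.trace_smulRight]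
  simp [inner_sub_right, inner_add_right, inner_smul_right, LinearMap.trace_id]
  ring

theorem inner_grad (f : Sph n → ℝ) (p : Sph n) (v : Ambient n) :
    inner ℝ (grad f p) v = fderiv ℝ (radialExt f) p v := by
  rw [grad, ← InnerProductSpace.toDual_apply_apply (𝕜 := ℝ), gradient,
    LinearIsometryEquiv.apply_symm_apply]

theorem div_smul {f : Sph n → ℝ} {Y : Sph n → Ambient n} {p : Sph n}
    (hf : DifferentiableAt ℝ (radialExt f) (p : Ambient n))
    (hY : DifferentiableAt ℝ (radialExt Y) (p : Ambient n)) :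
    div (fun q => f q • Y q) p = f p * div Y p + inner ℝ (grad f p) (Y p) := by
  rw [div, radialExt_map₂ (smul_zero 0), (hf.hasFDerivAt.fun_smul hY.hasFDerivAt).fderiv,
    ContinuousLinearMap.toLinearMap_add, map_add, toLinearMap_smulRight,
    LinearMap.trace_smulRight, ContinuousLinearMap.toLinearMap_smul, map_smul, radialExt_coe,
    radialExt_coe, div, inner_grad]
  rfl

theorem div_sub {X Y : Sph n → Ambient n} {p : Sph n}
    (hX : DifferentiableAt ℝ (radialExt X) (p : Ambient n))
    (hY : DifferentiableAt ℝ (radialExt Y) (p : Ambient n)) :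
    div (fun q => X q - Y q) p = div X p - div Y p := by
  rw [div, radialExt_map₂ (sub_zero 0), (hX.hasFDerivAt.fun_sub hY.hasFDerivAt).fderiv,
    ContinuousLinearMap.toLinearMap_sub, map_sub, div, div]

theorem contDiffAt_radialExt {f : Sph n → ℝ} (hf : ContMDiff (𝓡 n) 𝓘(ℝ, ℝ) ∞ f)
    {x : Ambient n} (hx : x ≠ 0) : ContDiffAt ℝ ∞ (radialExt f) x := by
  let U : TopologicalSpace.Opens (Ambient n) := ⟨{0}ᶜ, isOpen_compl_singleton⟩
  have hnormalize : ContMDiff 𝓘(ℝ, Ambient n) 𝓘(ℝ, Ambient n) ∞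
      (fun y : U => ‖(y : Ambient n)‖⁻¹ • (y : Ambient n)) := fun y =>
    contMDiffAt_subtype_iff.mpr
      (contDiffAt_norm_inv_smul (x := (y : Ambient n)) y.2).contMDiffAt
  have hcomp := hf.comp
    (hnormalize.codRestrict_sphere (n := n) fun y => (proj (y : Ambient n) y.2).2)
  have hsubtype : ContMDiffAt 𝓘(ℝ, Ambient n) 𝓘(ℝ, ℝ) ∞
      (fun y : U => radialExt f (y : Ambient n)) ⟨x, hx⟩ := by
    convert hcomp ⟨x, hx⟩ using 1
    exact funext fun y => radialExt_of_ne_zero f y.2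
  exact (contMDiffAt_subtype_iff.mp hsubtype).contDiffAt

theorem contDiffAt_radialExt_grad {f : Sph n → ℝ} (hf : ContMDiff (𝓡 n) 𝓘(ℝ, ℝ) ∞ f)
    {x : Ambient n} (hx : x ≠ 0) : ContDiffAt ℝ ∞ (radialExt (grad f)) x := by
  have hgradient : ContDiffAt ℝ ∞ (gradient (radialExt f)) (‖x‖⁻¹ • x) :=
    ((InnerProductSpace.toDual ℝ (Ambient n)).symm.toContinuousLinearEquiv.contDiff
      (n := ∞)).contDiffAt.comp _
      ((contDiffAt_radialExt hf (smul_ne_zero (by simpa using hx) hx)).fderiv_right (by simp))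
  exact (ContDiffAt.comp (f := fun y : Ambient n => ‖y‖⁻¹ • y) x hgradient
    (contDiffAt_norm_inv_smul hx)).congr_of_eventuallyEq
      (radialExt_restrict_eventuallyEq (gradient (radialExt f)) hx)

theorem inner_grad_self {f : Sph n → ℝ} (hf : ContMDiff (𝓡 n) 𝓘(ℝ, ℝ) ∞ f) (p : Sph n) :
    inner ℝ (grad f p) (p : Ambient n) = 0 := by
  rw [inner_grad]
  exact fderiv_radialExt_self
    ((contDiffAt_radialExt hf (coe_ne_zero p)).differentiableAt (by simp))

end Calculus

section AmbientDivergence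

variable {E F : Type*} [NormedAddCommGroup E] [NormedSpace ℝ E] [NormedAddCommGroup F]
  [NormedSpace ℝ F] [MeasurableSpace E] [BorelSpace E] {μ : Measure E}

theorem integrable_fderiv_of_hasCompactSupport [IsFiniteMeasureOnCompacts μ] {V : E → F}
    (hV : ContDiff ℝ 1 V) (hc : HasCompactSupport V) : Integrable (fderiv ℝ V) μ :=
  (hV.continuous_fderiv (by simp)).integrable_of_hasCompactSupport (hc.fderiv ℝ)

variable [FiniteDimensional ℝ E] [μ.IsAddHaarMeasure]

theorem integral_fderiv_apply_eq_zero {V : E → F} (hV : ContDiff ℝ 1 V)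
    (hc : HasCompactSupport V) (v : E) : ∫ x, fderiv ℝ V x v ∂μ = 0 := by
  have h := integral_smul_fderiv_eq_neg_fderiv_smul_of_integrable (μ := μ) (𝕜 := ℝ)
    (f := fun _ => 1) (g := V) (v := v) (by simp)
    (by simpa using (integrable_fderiv_of_hasCompactSupport hV hc).apply_continuousLinearMap v)
    (by simpa using hV.continuous.integrable_of_hasCompactSupport hc) (by fun_prop)
    fun x _ => hV.differentiable (by simp) x
  simpa using h

theorem integral_trace_fderiv_eq_zero {V : E → E} (hV : ContDiff ℝ 1 V)
    (hc : HasCompactSupport V) :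
    ∫ x, LinearMap.trace ℝ E (fderiv ℝ V x : E →ₗ[ℝ] E) ∂μ = 0 := by
  let tr : (E →L[ℝ] E) →L[ℝ] ℝ :=
    LinearMap.toContinuousLinearMap (LinearMap.trace ℝ E ∘ₗ ContinuousLinearMap.coeLM ℝ)
  have hint := integrable_fderiv_of_hasCompactSupport (μ := μ) hV hc
  have hzero : ∫ x, fderiv ℝ V x ∂μ = 0 := by
    ext v
    rw [ContinuousLinearMap.integral_apply hint, integral_fderiv_apply_eq_zero hV hc]
    rfl
  exact (tr.integral_comp_comm hint).trans (by rw [hzero, map_zero])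

end AmbientDivergence

section Cutoff

variable {E F : Type*} [NormedAddCommGroup E] [NormedAddCommGroup F] [NormedSpace ℝ F]

/-- A smooth bump on the real line which equals `1` near `1` and is supported in
`[1 / 2, 3 / 2]`. -/
def bumpOne : ContDiffBump (1 : ℝ) := ⟨1 / 4, 1 / 2, by norm_num, by norm_num⟩

/-- A smooth radial cutoff supported in an annulus around the unit sphere. -/
def annularCutoff (x : E) : ℝ := bumpOne (‖x‖ ^ 2)

theorem annularCutoff_nonneg (x : E) : 0 ≤ annularCutoff x := bumpOne.nonneg

theorem annularCutoff_of_norm_eq_one {x : E} (hx : ‖x‖ = 1) : annularCutoff x = 1 := by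
  rw [annularCutoff, hx, one_pow]
  exact bumpOne.one_of_mem_closedBall (mem_closedBall_self bumpOne.rIn_pos.le)

theorem annularCutoff_eq_zero {x : E} (hx : 1 / 2 ≤ |‖x‖ ^ 2 - 1|) : annularCutoff x = 0 :=
  bumpOne.zero_of_le_dist hx

theorem annularCutoff_eventuallyEq_zero : (annularCutoff : E → ℝ) =ᶠ[nhds 0] 0 := by
  have hsmall : ∀ᶠ x in nhds (0 : E), ‖x‖ ^ 2 < 1 / 2 :=
    (continuous_norm.pow 2).continuousAt.eventually_lt continuousAt_const (by norm_num)
  filter_upwards [hsmall] with x hx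
  exact annularCutoff_eq_zero (le_abs.mpr (Or.inr (by linarith)))

theorem hasCompactSupport_annularCutoff [ProperSpace E] :
    HasCompactSupport (annularCutoff : E → ℝ) := by
  refine HasCompactSupport.intro (isCompact_closedBall (0 : E) 2) fun x hx => ?_
  rw [mem_closedBall_zero_iff, not_le] at hx
  exact annularCutoff_eq_zero (le_abs.mpr (Or.inl (by nlinarith)))

variable [InnerProductSpace ℝ E]

theorem contDiff_annularCutoff {k : ℕ∞} : ContDiff ℝ k (annularCutoff (E := E)) :=
  bumpOne.contDiff.comp (contDiff_norm_sq ℝ)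

theorem fderiv_annularCutoff_of_inner_eq_zero {x v : E} (hv : inner ℝ x v = 0) :
    fderiv ℝ annularCutoff x v = 0 := by
  have hbump : HasDerivAt bumpOne (deriv bumpOne (‖x‖ ^ 2)) (‖x‖ ^ 2) :=
    ((bumpOne.contDiff (n := 1)).differentiable (by simp) _).hasDerivAt
  have h := hbump.comp_hasFDerivAt x (hasStrictFDerivAt_norm_sq x).hasFDerivAt
  rw [show annularCutoff = (bumpOne : ℝ → ℝ) ∘ fun y : E => ‖y‖ ^ 2 from rfl, h.fderiv]
  simp [hv]

theorem contDiff_annularCutoff_smul {k : ℕ∞} {V : E → F}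
    (hV : ∀ x, x ≠ 0 → ContDiffAt ℝ k V x) : ContDiff ℝ k fun x => annularCutoff x • V x := by
  rw [contDiff_iff_contDiffAt]
  intro x
  rcases eq_or_ne x 0 with rfl | hx
  · refine (contDiffAt_const (c := (0 : F))).congr_of_eventuallyEq ?_
    filter_upwards [annularCutoff_eventuallyEq_zero] with y hy
    simp [hy]
  · exact contDiff_annularCutoff.contDiffAt.smul (hV x hx)

end Cutoff

section Divergence

variable {n : ℕ}

instance : IsFiniteMeasure (vol n) := by unfold vol; infer_instance

instance : (vol n).IsOpenPosMeasure := by unfold vol; infer_instance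

theorem integral_norm_mul_radialExt (g : ℝ → ℝ) (f : Sph n → ℝ) :
    ∫ x : Ambient n, g ‖x‖ * radialExt f x =
      (∫ r : Set.Ioi (0 : ℝ), g r ∂Measure.volumeIoiPow n) * ∫ p, f p ∂vol n := by
  have hpolar : MeasurePreserving (homeomorphUnitSphereProd (Ambient n))
      ((volume : Measure (Ambient n)).comap (↑)) ((vol n).prod (Measure.volumeIoiPow n)) := by
    simpa [vol] using (volume : Measure (Ambient n)).measurePreserving_homeomorphUnitSphereProd
  calc ∫ x : Ambient n, g ‖x‖ * radialExt f x
      = ∫ x : ({0}ᶜ : Set (Ambient n)), g ‖(x : Ambient n)‖ * radialExt f x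
          ∂((volume : Measure (Ambient n)).comap (↑)) := by
        rw [integral_subtype_comap (measurableSet_singleton _).compl
          fun x : Ambient n => g ‖x‖ * radialExt f x, restrict_compl_singleton]
    _ = ∫ x : ({0}ᶜ : Set (Ambient n)), (fun z : Sph n × Set.Ioi (0 : ℝ) => f z.1 * g z.2)
          (homeomorphUnitSphereProd (Ambient n) x)
          ∂((volume : Measure (Ambient n)).comap (↑)) := by
        congr 1
        funext x
        have hx : (x : Ambient n) ≠ 0 := x.2
        have hproj : (homeomorphUnitSphereProd (Ambient n) x).1 = proj (x : Ambient n) hx :=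
          Subtype.ext (homeomorphUnitSphereProd_apply_fst_coe _ x)
        rw [radialExt_of_ne_zero f hx, ← hproj, mul_comm]
        simp only [homeomorphUnitSphereProd_apply_snd_coe]
    _ = _ := by
        rw [mul_comm]
        exact (hpolar.integral_comp (Homeomorph.measurableEmbedding _)
          fun z : Sph n × Set.Ioi (0 : ℝ) => f z.1 * g z.2).trans
            (integral_prod_mul f fun r : Set.Ioi (0 : ℝ) => g r)

theorem integral_bumpOne_volumeIoiPow_ne_zero :
    ∫ r : Set.Ioi (0 : ℝ), bumpOne ((r : ℝ) ^ 2) * (r : ℝ)⁻¹ ∂Measure.volumeIoiPow n ≠ 0 := by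
  intro hzero
  have hcont : Continuous fun x : Ambient n => annularCutoff x * ‖x‖⁻¹ :=
    (contDiff_annularCutoff_smul (k := 0) fun x hx =>
      (contDiffAt_norm ℝ hx).inv (norm_ne_zero_iff.mpr hx)).continuous
  have hpos : 0 < ∫ x : Ambient n, annularCutoff x * ‖x‖⁻¹ :=
    hcont.integral_pos_of_hasCompactSupport_nonneg_nonzero
      hasCompactSupport_annularCutoff.mul_right
      (fun x => mul_nonneg (annularCutoff_nonneg x) (by positivity))
      (x := EuclideanSpace.single 0 1) (by simp [annularCutoff_of_norm_eq_one])
  have hpolar := integral_norm_mul_radialExt (n := n) (fun r => bumpOne (r ^ 2) * r⁻¹) 1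
  rw [hzero, zero_mul] at hpolar
  refine hpos.ne' (Eq.trans (integral_congr_ae ?_) hpolar)
  filter_upwards [Measure.ae_ne volume 0] with x hx
  simp [radialExt_of_ne_zero _ hx, annularCutoff]

theorem trace_fderiv_annularCutoff_smul {X : Sph n → Ambient n}
    (hX : ∀ x : Ambient n, x ≠ 0 → DifferentiableAt ℝ (radialExt X) x)
    (htangent : ∀ p : Sph n, inner ℝ (X p) (p : Ambient n) = 0) (x : Ambient n) :
    LinearMap.trace ℝ (Ambient n) (fderiv ℝ (fun y => annularCutoff y • radialExt X y) x :
      Ambient n →ₗ[ℝ] Ambient n) = annularCutoff x * ‖x‖⁻¹ * radialExt (div X) x := by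
  rcases eq_or_ne x 0 with rfl | hx
  · have hzero : (fun y => annularCutoff y • radialExt X y) =ᶠ[nhds 0] fun _ => 0 := by
      filter_upwards [annularCutoff_eventuallyEq_zero] with y hy
      simp [hy]
    rw [hzero.fderiv_eq]
    simp
  · have horth : inner ℝ x (radialExt X x) = 0 := by
      have h := htangent (proj x hx)
      rw [coe_proj, inner_smul_right, ← radialExt_of_ne_zero X hx] at h
      rw [real_inner_comm]
      exact (mul_eq_zero.mp h).resolve_left (by simpa using hx)
    have hdiv : LinearMap.trace ℝ (Ambient n) (fderiv ℝ (radialExt X) x :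
        Ambient n →ₗ[ℝ] Ambient n) = ‖x‖⁻¹ * radialExt (div X) x := by
      rw [fderiv_radialExt_smul X (c := ‖x‖⁻¹) (by positivity), radialExt_of_ne_zero _ hx, div,
        coe_proj, ContinuousLinearMap.toLinearMap_smul, map_smul, smul_eq_mul]
    have hcutoff : DifferentiableAt ℝ annularCutoff x :=
      (contDiff_annularCutoff (k := 1)).differentiable (by simp) x
    rw [(hcutoff.hasFDerivAt.fun_smul (hX x hx).hasFDerivAt).fderiv,
      ContinuousLinearMap.toLinearMap_add, map_add, toLinearMap_smulRight,
      LinearMap.trace_smulRight, ContinuousLinearMap.toLinearMap_smul, map_smul, hdiv]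
    simp [fderiv_annularCutoff_of_inner_eq_zero horth, mul_assoc]

theorem integral_div_eq_zero {X : Sph n → Ambient n}
    (hX : ∀ x : Ambient n, x ≠ 0 → ContDiffAt ℝ 1 (radialExt X) x)
    (htangent : ∀ p : Sph n, inner ℝ (X p) (p : Ambient n) = 0) :
    ∫ p, div X p ∂vol n = 0 := by
  have h := integral_trace_fderiv_eq_zero (μ := volume) (contDiff_annularCutoff_smul hX)
    hasCompactSupport_annularCutoff.smul_right
  simp_rw [trace_fderiv_annularCutoff_smul
    (fun x hx => (hX x hx).differentiableAt (by simp)) htangent] at h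
  exact (mul_eq_zero.mp ((integral_norm_mul_radialExt (fun r => bumpOne (r ^ 2) * r⁻¹)
    (div X)).symm.trans h)).resolve_left integral_bumpOne_volumeIoiPow_ne_zero

theorem integral_mul_laplaceBeltrami_sub_eq_zero {f g : Sph n → ℝ}
    (hf : ContMDiff (𝓡 n) 𝓘(ℝ, ℝ) ∞ f) (hg : ContMDiff (𝓡 n) 𝓘(ℝ, ℝ) ∞ g) :
    ∫ p, (f p * laplaceBeltrami g p - g p * laplaceBeltrami f p) ∂vol n = 0 := by
  have hflux : ∀ {u v : Sph n → ℝ}, ContMDiff (𝓡 n) 𝓘(ℝ, ℝ) ∞ u →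
      ContMDiff (𝓡 n) 𝓘(ℝ, ℝ) ∞ v → ∀ x : Ambient n, x ≠ 0 →
      ContDiffAt ℝ ∞ (radialExt fun q => u q • grad v q) x := fun hu hv x hx => by
    rw [radialExt_map₂ (smul_zero 0)]
    exact (contDiffAt_radialExt hu hx).smul (contDiffAt_radialExt_grad hv hx)
  have hdiv : ∀ p, div (fun q => g q • grad f q - f q • grad g q) p =
      f p * laplaceBeltrami g p - g p * laplaceBeltrami f p := fun p => by
    have hp := coe_ne_zero p
    have hd : ∀ {F : Type} [NormedAddCommGroup F] [NormedSpace ℝ F] {u : Sph n → F},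
        ContDiffAt ℝ ∞ (radialExt u) (p : Ambient n) →
        DifferentiableAt ℝ (radialExt u) (p : Ambient n) := fun h => h.differentiableAt (by simp)
    rw [div_sub (hd (hflux hg hf _ hp)) (hd (hflux hf hg _ hp)),
      div_smul (hd (contDiffAt_radialExt hg hp)) (hd (contDiffAt_radialExt_grad hf hp)),
      div_smul (hd (contDiffAt_radialExt hf hp)) (hd (contDiffAt_radialExt_grad hg hp)),
      laplaceBeltrami, laplaceBeltrami, real_inner_comm]
    ring
  simp_rw [← hdiv]
  refine integral_div_eq_zero (fun x hx => ?_) fun p => ?_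
  · rw [radialExt_map₂ (sub_zero 0)]
    exact ((hflux hg hf x hx).sub (hflux hf hg x hx)).of_le (by simp)
  · rw [inner_sub_left, inner_smul_left, inner_smul_left, inner_grad_self hf, inner_grad_self hg]
    simp

end Divergence

section PolynomialLaplacian

open MvPolynomial

variable {σ R : Type*} [CommSemiring R]

theorem pderiv_eq_zero_of_isHomogeneous_zero {P : MvPolynomial σ R} (hP : P.IsHomogeneous 0)
    (i : σ) : pderiv i P = 0 := by
  rw [← totalDegree_zero_iff_isHomogeneous, totalDegree_eq_zero_iff_eq_C] at hP
  rw [hP, pderiv_C]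

variable [Fintype σ]

/-- The Euclidean Laplacian `∑ᵢ ∂ᵢ²` on polynomials (with the sign opposite to the one in
`laplaceBeltrami`). -/
def polyLaplacian : MvPolynomial σ R →ₗ[R] MvPolynomial σ R :=
  ∑ i, (pderiv i).toLinearMap ∘ₗ (pderiv i).toLinearMap

theorem polyLaplacian_apply (P : MvPolynomial σ R) :
    polyLaplacian P = ∑ i, pderiv i (pderiv i P) := by
  simp [polyLaplacian]

theorem isHomogeneous_polyLaplacian {P : MvPolynomial σ R} {k : ℕ} (hP : P.IsHomogeneous k) :
    (polyLaplacian P).IsHomogeneous (k - 2) := by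
  rw [polyLaplacian_apply]
  exact IsHomogeneous.sum _ _ _ fun _ _ => hP.pderiv.pderiv

theorem polyLaplacian_eq_zero_of_lt_two {P : MvPolynomial σ R} {k : ℕ} (hP : P.IsHomogeneous k)
    (hk : k < 2) : polyLaplacian P = 0 := by
  rw [polyLaplacian_apply]
  refine Finset.sum_eq_zero fun i _ => pderiv_eq_zero_of_isHomogeneous_zero ?_ i
  simpa only [show k - 1 = 0 by omega] using hP.pderiv (i := i)

theorem polyLaplacian_mul (P Q : MvPolynomial σ R) :
    polyLaplacian (P * Q) =
      polyLaplacian P * Q + 2 * ∑ i, pderiv i P * pderiv i Q + P * polyLaplacian Q := by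
  simp only [polyLaplacian_apply, pderiv_mul, map_add, Finset.sum_mul, Finset.mul_sum,
    ← Finset.sum_add_distrib]
  exact Finset.sum_congr rfl fun i _ => by ring

theorem polyLaplacian_X_pow (i : σ) (a : ℕ) :
    polyLaplacian (X i ^ a : MvPolynomial σ R) =
      (a * (a - 1 : ℕ) : MvPolynomial σ R) * X i ^ (a - 2) := by
  classical
  rw [polyLaplacian_apply, Finset.sum_eq_single i]
  · rw [pderiv_pow, pderiv_X_self, mul_one, ← map_natCast (C : R →+* MvPolynomial σ R),
      pderiv_C_mul, pderiv_pow, pderiv_X_self, Nat.sub_sub, map_natCast]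
    ring
  · intro j _ hj
    simp [pderiv_X_of_ne hj.symm]
  · simp

/-- The squared Euclidean norm `∑_{i ∈ s} Xᵢ²` of the coordinates in `s`. -/
def sumSq (s : Finset σ) : MvPolynomial σ R := ∑ i ∈ s, X i ^ 2

omit [Fintype σ] in
theorem isHomogeneous_sumSq (s : Finset σ) : (sumSq s : MvPolynomial σ R).IsHomogeneous 2 :=
  IsHomogeneous.sum _ _ _ fun i _ => by simpa using (isHomogeneous_X R i).pow 2

omit [Fintype σ] in
theorem pderiv_sumSq [DecidableEq σ] (s : Finset σ) (i : σ) :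
    pderiv i (sumSq s : MvPolynomial σ R) = if i ∈ s then 2 * X i else 0 := by
  simp [sumSq, pderiv_X, Pi.single_apply]

theorem sum_pderiv_sumSq_mul_self (s : Finset σ) :
    ∑ i, pderiv i (sumSq s : MvPolynomial σ R) * pderiv i (sumSq s) = 4 * sumSq s := by
  classical
  have hterm (i : σ) : pderiv i (sumSq s : MvPolynomial σ R) * pderiv i (sumSq s) =
      if i ∈ s then 4 * X i ^ 2 else 0 := by
    rw [pderiv_sumSq]
    split_ifs <;> ring
  simp only [hterm, Finset.sum_ite_mem, Finset.univ_inter, ← Finset.mul_sum]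
  rfl

theorem polyLaplacian_sumSq (s : Finset σ) :
    polyLaplacian (sumSq s : MvPolynomial σ R) = 2 * s.card := by
  classical
  have hterm (i : σ) : pderiv i (pderiv i (sumSq s : MvPolynomial σ R)) =
      if i ∈ s then 2 else 0 := by
    rw [pderiv_sumSq, ← map_ofNat (C : R →+* MvPolynomial σ R)]
    split_ifs
    · rw [pderiv_C_mul, pderiv_X_self, mul_one]
    · exact map_zero _
  simp [polyLaplacian_apply, hterm, mul_comm]

theorem polyLaplacian_sumSq_pow_succ (s : Finset σ) (j : ℕ) :
    polyLaplacian (sumSq s ^ (j + 1) : MvPolynomial σ R) =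
      (2 * (j + 1) * (2 * j + s.card) : MvPolynomial σ R) * sumSq s ^ j := by
  induction j with
  | zero => simp [polyLaplacian_sumSq]
  | succ j ih =>
    have hcross : ∑ i, pderiv i (sumSq s ^ (j + 1) : MvPolynomial σ R) * pderiv i (sumSq s) =
        ((j + 1) * 4 : MvPolynomial σ R) * sumSq s ^ (j + 1) := by
      simp_rw [pderiv_pow, mul_assoc, ← Finset.mul_sum, sum_pderiv_sumSq_mul_self]
      push_cast
      ring
    rw [pow_succ, polyLaplacian_mul, ih, hcross, polyLaplacian_sumSq]
    push_cast
    ring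

theorem polyLaplacian_X_pow_mul_sumSq_pow {i : σ} {s : Finset σ} (hi : i ∉ s) (a j : ℕ) :
    polyLaplacian (X i ^ a * sumSq s ^ j : MvPolynomial σ R) =
      polyLaplacian (X i ^ a) * sumSq s ^ j + X i ^ a * polyLaplacian (sumSq s ^ j) := by
  classical
  have hcross : ∀ l, pderiv l (X i ^ a : MvPolynomial σ R) * pderiv l (sumSq s ^ j) = 0 := by
    intro l
    rcases eq_or_ne i l with rfl | hl
    · simp [pderiv_sumSq, hi]
    · simp [pderiv_X_of_ne hl]
  simp only [polyLaplacian_mul, hcross, Finset.sum_const_zero, mul_zero, add_zero]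

end PolynomialLaplacian

section PolynomialFunctions

open MvPolynomial

variable {ι : Type*} [Fintype ι]

/-- The function on Euclidean space given by a polynomial. -/
def polyFun (P : MvPolynomial ι ℝ) (x : EuclideanSpace ℝ ι) : ℝ := eval (fun i => x i) P

/-- The gradient field of a polynomial. -/
def polyGrad (P : MvPolynomial ι ℝ) (x : EuclideanSpace ℝ ι) : EuclideanSpace ℝ ι :=
  WithLp.toLp 2 fun i => polyFun (pderiv i P) x

theorem inner_polyGrad (P : MvPolynomial ι ℝ) (x v : EuclideanSpace ℝ ι) :
    inner ℝ (polyGrad P x) v = ∑ i, polyFun (pderiv i P) x * v i := by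
  simp [polyGrad, PiLp.inner_apply, mul_comm]

theorem contDiff_polyFun {k : WithTop ℕ∞} (P : MvPolynomial ι ℝ) : ContDiff ℝ k (polyFun P) :=
  (AnalyticOnNhd.eval_continuousLinearMap' (fun i => (EuclideanSpace.proj i :
    EuclideanSpace ℝ ι →L[ℝ] ℝ)) P).contDiff

theorem hasGradientAt_polyFun (P : MvPolynomial ι ℝ) (x : EuclideanSpace ℝ ι) :
    HasGradientAt (polyFun P) (polyGrad P x) x := by
  classical
  rw [hasGradientAt_iff_hasFDerivAt]
  induction P using MvPolynomial.induction_on with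
  | C a =>
    have h : polyFun (C a : MvPolynomial ι ℝ) = fun _ => a := by funext y; simp [polyFun]
    rw [h]
    refine (hasFDerivAt_const a x).congr_fderiv ?_
    ext1 v
    simp [inner_polyGrad, polyFun]
  | add P Q hP hQ =>
    have h : polyFun (P + Q) = fun y => polyFun P y + polyFun Q y := by
      funext y; simp [polyFun]
    rw [h]
    refine (hP.fun_add hQ).congr_fderiv ?_
    ext1 v
    simp [inner_polyGrad, polyFun, add_mul, Finset.sum_add_distrib]
  | mul_X P j hP =>
    have h : polyFun (P * X j) = fun y => polyFun P y * y j := by funext y; simp [polyFun]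
    rw [h]
    have hj := (EuclideanSpace.proj j : EuclideanSpace ℝ ι →L[ℝ] ℝ).hasFDerivAt (x := x)
    refine (hP.fun_mul hj).congr_fderiv ?_
    ext1 v
    simp only [add_apply, smul_apply, InnerProductSpace.toDual_apply_apply, inner_polyGrad]
    simp [polyFun, pderiv_X, Pi.single_apply, apply_ite, add_mul, mul_assoc,
      Finset.sum_add_distrib, Finset.mul_sum]

/-- The derivative of `polyGrad P` at a point, i.e. the Hessian of a polynomial as an
endomorphism. -/
def polyHess (P : MvPolynomial ι ℝ) (x : EuclideanSpace ℝ ι) :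
    EuclideanSpace ℝ ι →L[ℝ] EuclideanSpace ℝ ι :=
  (PiLp.continuousLinearEquiv 2 ℝ fun _ : ι => ℝ).symm.toContinuousLinearMap.comp
    (ContinuousLinearMap.pi fun i => innerSL ℝ (polyGrad (pderiv i P) x))

theorem polyHess_apply (P : MvPolynomial ι ℝ) (x v : EuclideanSpace ℝ ι) (i : ι) :
    polyHess P x v i = inner ℝ (polyGrad (pderiv i P) x) v := by
  simp [polyHess]

theorem hasFDerivAt_polyGrad (P : MvPolynomial ι ℝ) (x : EuclideanSpace ℝ ι) :
    HasFDerivAt (polyGrad P) (polyHess P x) x :=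
  (PiLp.continuousLinearEquiv 2 ℝ fun _ : ι => ℝ).symm.hasFDerivAt.comp x
    (hasFDerivAt_pi.mpr fun i => (hasGradientAt_polyFun (pderiv i P) x).hasFDerivAt)

theorem trace_polyHess (P : MvPolynomial ι ℝ) (x : EuclideanSpace ℝ ι) :
    LinearMap.trace ℝ (EuclideanSpace ℝ ι)
      (polyHess P x : EuclideanSpace ℝ ι →ₗ[ℝ] EuclideanSpace ℝ ι) =
      polyFun (polyLaplacian P) x := by
  classical
  rw [LinearMap.trace_eq_sum_inner _ (EuclideanSpace.basisFun ι ℝ)]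
  simp [EuclideanSpace.inner_single_left, polyHess_apply, inner_polyGrad, polyLaplacian_apply,
    polyFun]

theorem inner_polyGrad_self {P : MvPolynomial ι ℝ} {k : ℕ} (hP : P.IsHomogeneous k)
    (x : EuclideanSpace ℝ ι) : inner ℝ (polyGrad P x) x = k * polyFun P x := by
  have h := congrArg (polyFun · x) hP.sum_X_mul_pderiv
  simpa [inner_polyGrad, polyFun, mul_comm] using h

theorem inner_polyHess_self {P : MvPolynomial ι ℝ} {k : ℕ} (hP : P.IsHomogeneous k)
    (x : EuclideanSpace ℝ ι) : inner ℝ x (polyHess P x x) = (k - 1) * (k * polyFun P x) := by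
  have hpderiv : ∀ i, polyHess P x x i = (k - 1) * polyFun (pderiv i P) x := fun i => by
    rw [polyHess_apply, inner_polyGrad_self hP.pderiv]
    rcases k with _ | k
    · simp [pderiv_eq_zero_of_isHomogeneous_zero hP, polyFun]
    · simp
  rw [← inner_polyGrad_self hP, inner_polyGrad, Finset.mul_sum, PiLp.inner_apply]
  refine Finset.sum_congr rfl fun i _ => ?_
  rw [hpderiv]
  simp [mul_assoc]

end PolynomialFunctions

section SphericalHarmonics

variable {n : ℕ}

theorem contMDiff_polyFun (P : MvPolynomial (Fin (n + 1)) ℝ) :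
    ContMDiff (𝓡 n) 𝓘(ℝ, ℝ) ∞ fun p : Sph n => polyFun P p :=
  (contDiff_polyFun P).contMDiff.comp contMDiff_coe_sphere

theorem laplaceBeltrami_polyFun {P : MvPolynomial (Fin (n + 1)) ℝ} {k : ℕ}
    (hP : P.IsHomogeneous k) (p : Sph n) :
    laplaceBeltrami (fun q : Sph n => polyFun P q) p =
      k * (k + n - 1) * polyFun P p - polyFun (polyLaplacian P) p := by
  rw [laplaceBeltrami_restrict (fun q : Sph n => hasGradientAt_polyFun P q)
    (hasFDerivAt_polyGrad P p), trace_polyHess, inner_polyGrad_self hP, inner_polyHess_self hP]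
  ring

end SphericalHarmonics

section Density

variable {X : Type*} [TopologicalSpace X] [CompactSpace X] [MeasurableSpace X] [BorelSpace X]
  {μ : Measure X} [IsFiniteMeasure μ]

theorem integrable_of_continuous {f : X → ℝ} (hf : Continuous f) : Integrable f μ :=
  hf.integrable_of_hasCompactSupport (HasCompactSupport.of_compactSpace f)

theorem continuous_integral_continuousMap : Continuous fun g : C(X, ℝ) => ∫ x, g x ∂μ := by
  have h := continuous_integral.comp (ContinuousMap.toLp (E := ℝ) 1 μ ℝ).continuous
  refine h.congr fun g => integral_congr_ae (ContinuousMap.coeFn_toLp μ g)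

theorem eq_zero_of_forall_integral_mul_eq_zero [μ.IsOpenPosMeasure] {A : Subalgebra ℝ C(X, ℝ)}
    (hA : A.SeparatesPoints) {f : C(X, ℝ)} (hf : ∀ g ∈ A, ∫ x, f x * g x ∂μ = 0) : f = 0 := by
  have hclosed : IsClosed {g : C(X, ℝ) | ∫ x, (f * g) x ∂μ = 0} :=
    isClosed_singleton.preimage
      ((continuous_integral_continuousMap (μ := μ)).comp (continuous_const.mul continuous_id))
  have hmem : f ∈ A.topologicalClosure := by
    rw [ContinuousMap.subalgebra_topologicalClosure_eq_top_of_separatesPoints A hA]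
    trivial
  have hzero : ∫ x, f x * f x ∂μ = 0 := hclosed.closure_subset_iff.mpr hf hmem
  have hcont : Continuous fun x => f x * f x := by fun_prop
  have hae := (integral_eq_zero_iff_of_nonneg (fun x => mul_self_nonneg (f x))
    (integrable_of_continuous hcont)).mp hzero
  ext x
  exact mul_self_eq_zero.mp (congrFun ((hcont.ae_eq_iff_eq μ continuous_const).mp hae) x)

end Density

section Spectrum

open MvPolynomial

variable {n : ℕ}

/-- Restriction of polynomials to the sphere, as an algebra homomorphism. -/
def polyRestrict (n : ℕ) : MvPolynomial (Fin (n + 1)) ℝ →ₐ[ℝ] C(Sph n, ℝ) :=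
  aeval fun i => ⟨fun p => (p : Ambient n) i, by fun_prop⟩

theorem polyRestrict_apply (P : MvPolynomial (Fin (n + 1)) ℝ) (p : Sph n) :
    polyRestrict n P p = polyFun P p := by
  have h : (ContinuousMap.evalAlgHom ℝ ℝ p).comp (polyRestrict n) =
      aeval fun i => (p : Ambient n) i := by
    ext i
    simp [polyRestrict]
  simpa [polyFun, aeval_eq_eval] using DFunLike.congr_fun h P

theorem separatesPoints_range_polyRestrict : (polyRestrict n).range.SeparatesPoints := by
  intro p q hpq
  obtain ⟨i, hi⟩ : ∃ i, (p : Ambient n) i ≠ (q : Ambient n) i := by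
    by_contra! h
    exact hpq (Subtype.ext (PiLp.ext h))
  exact ⟨_, ⟨_, ⟨X i, rfl⟩, rfl⟩, by simpa [polyRestrict_apply, polyFun] using hi⟩

theorem integrable_mul_polyFun {φ : Sph n → ℝ} (hφ : Continuous φ)
    (P : MvPolynomial (Fin (n + 1)) ℝ) : Integrable (fun p => φ p * polyFun P p) (vol n) :=
  integrable_of_continuous (hφ.mul (contMDiff_polyFun P).continuous)

theorem integral_mul_polyFun_eq_zero_of_isHomogeneous {lam : ℝ} {φ : Sph n → ℝ}
    (hφ : ContMDiff (𝓡 n) 𝓘(ℝ, ℝ) ∞ φ) (heigen : ∀ p, laplaceBeltrami φ p = lam * φ p)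
    (hlam : ∀ k : ℕ, lam ≠ k * (k + n - 1)) {k : ℕ} {Q : MvPolynomial (Fin (n + 1)) ℝ}
    (hQ : Q.IsHomogeneous k) : ∫ p, φ p * polyFun Q p ∂vol n = 0 := by
  induction k using Nat.strong_induction_on generalizing Q with
  | _ k ih =>
    have hlaplacian : ∫ p, φ p * polyFun (polyLaplacian Q) p ∂vol n = 0 := by
      by_cases hk : k < 2
      · simp [polyLaplacian_eq_zero_of_lt_two hQ hk, polyFun]
      · exact ih (k - 2) (by omega) (isHomogeneous_polyLaplacian hQ)
    have hsymm := integral_mul_laplaceBeltrami_sub_eq_zero hφ (contMDiff_polyFun Q)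
    have hexpand (p : Sph n) : φ p * laplaceBeltrami (fun q : Sph n => polyFun Q q) p -
        polyFun Q p * laplaceBeltrami φ p =
        (k * (k + n - 1) - lam) * (φ p * polyFun Q p) - φ p * polyFun (polyLaplacian Q) p := by
      rw [laplaceBeltrami_polyFun hQ, heigen]
      ring
    simp_rw [hexpand] at hsymm
    rw [integral_sub ((integrable_mul_polyFun hφ.continuous Q).const_mul _)
      (integrable_mul_polyFun hφ.continuous _), integral_const_mul, hlaplacian, sub_zero] at hsymm
    exact (mul_eq_zero.mp hsymm).resolve_left fun h => hlam k (by linarith)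

theorem integral_mul_polyFun_eq_zero {lam : ℝ} {φ : Sph n → ℝ}
    (hφ : ContMDiff (𝓡 n) 𝓘(ℝ, ℝ) ∞ φ) (heigen : ∀ p, laplaceBeltrami φ p = lam * φ p)
    (hlam : ∀ k : ℕ, lam ≠ k * (k + n - 1)) (P : MvPolynomial (Fin (n + 1)) ℝ) :
    ∫ p, φ p * polyFun P p ∂vol n = 0 := by
  have hsum (p : Sph n) : φ p * polyFun P p =
      ∑ k ∈ Finset.range (P.totalDegree + 1),
      φ p * polyFun (homogeneousComponent k P) p := by
    conv_lhs => rw [← sum_homogeneousComponent P]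
    simp [polyFun, Finset.mul_sum]
  simp_rw [hsum]
  rw [integral_finsetSum _ fun k _ => integrable_mul_polyFun hφ.continuous _]
  exact Finset.sum_eq_zero fun k _ => integral_mul_polyFun_eq_zero_of_isHomogeneous hφ heigen hlam
    (homogeneousComponent_isHomogeneous k P)

theorem exists_degree_of_isEigenvalue {lam : ℝ} (h : IsEigenvalue n lam) :
    ∃ k : ℕ, lam = k * (k + n - 1) := by
  obtain ⟨φ, hφ⟩ := h
  by_contra! hlam
  refine hφ.ne_zero (congrArg DFunLike.coe (eq_zero_of_forall_integral_mul_eq_zero (μ := vol n)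
    (f := ⟨φ, hφ.smooth.continuous⟩) separatesPoints_range_polyRestrict ?_))
  rintro _ ⟨P, rfl⟩
  simpa [polyRestrict_apply] using integral_mul_polyFun_eq_zero hφ.smooth hφ.eigen hlam P

end Spectrum

section Sturm

/-- The integrating factor `t ^ α (1 + t) ^ (-b)`, for which the equation
`(1 + t) (t q'' + α q') = b t q' - ν q` on the positive half-line becomes
`(p q')' + ν p q / (t (1 + t)) = 0`. -/
def sturmWeight (α b t : ℝ) : ℝ := t ^ α * (1 + t) ^ (-b)

theorem sturmWeight_pos (α b : ℝ) {t : ℝ} (ht : 0 < t) : 0 < sturmWeight α b t := by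
  unfold sturmWeight
  positivity

theorem sturmWeight_zero {α : ℝ} (hα : α ≠ 0) (b : ℝ) : sturmWeight α b 0 = 0 := by
  simp [sturmWeight, Real.zero_rpow hα]

theorem continuousOn_sturmWeight {α : ℝ} (hα : 0 ≤ α) (b : ℝ) :
    ContinuousOn (sturmWeight α b) (Set.Ici 0) := fun t ht =>
  ((Real.continuousAt_rpow_const t α (Or.inr hα)).mul
    ((continuousAt_const.add continuousAt_id).rpow_const
      (Or.inl (add_pos_of_pos_of_nonneg one_pos (Set.mem_Ici.mp ht)).ne'))).continuousWithinAt

theorem hasDerivAt_sturmWeight (α b : ℝ) {t : ℝ} (ht : 0 < t) :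
    HasDerivAt (sturmWeight α b) (sturmWeight α b t * (α / t - b / (1 + t))) t := by
  have h1 : 0 < 1 + t := by positivity
  have h := (Real.hasDerivAt_rpow_const (p := α) (Or.inl ht.ne')).mul
    (((hasDerivAt_id t).const_add 1).rpow_const (p := -b) (Or.inl h1.ne'))
  refine h.congr_deriv ?_
  rw [sturmWeight, Real.rpow_sub_one ht.ne', id, Real.rpow_sub_one h1.ne']
  field_simp
  ring

theorem sturm_supersolution_pos {α b ν T t : ℝ} (hα : 0 < α) (hb : 0 ≤ b) (hT : T ≤ 1)
    (hν : (1 + α) ^ 2 < ν * T) (ht : t ∈ Set.Ioo 0 T) :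
    0 < (1 + t) * (2 * t - 2 * α * (T - t)) + 2 * b * t * (T - t) + ν * (T - t) ^ 2 := by
  obtain ⟨ht0, htT⟩ := ht
  have hT0 : 0 < T := ht0.trans htT
  have hν0 : 0 < ν := pos_of_mul_pos_left ((by positivity : 0 ≤ (1 + α) ^ 2).trans_lt hν) hT0.le
  have : 0 < T - t := sub_pos.mpr htT
  have hdrift : 0 ≤ 2 * b * t * (T - t) := by positivity
  rcases le_or_gt 0 (2 * t - 2 * α * (T - t)) with hsign | hsign
  · have : 0 < ν * (T - t) ^ 2 := by positivity
    have : 0 ≤ (1 + t) * (2 * t - 2 * α * (T - t)) := mul_nonneg (by linarith) hsign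
    linarith
  · have hquadratic : 0 < 4 * T - 4 * (1 + α) * (T - t) + ν * (T - t) ^ 2 := by
      have hsq : ν * (4 * T - 4 * (1 + α) * (T - t) + ν * (T - t) ^ 2) =
          (ν * (T - t) - 2 * (1 + α)) ^ 2 + 4 * (ν * T - (1 + α) ^ 2) := by ring
      refine pos_of_mul_pos_right (hsq ▸ ?_) hν0.le
      have := sub_pos.mpr hν
      positivity
    have : 0 ≤ (1 - t) * -(2 * t - 2 * α * (T - t)) := mul_nonneg (by linarith) (by linarith)
    linarith

theorem exists_root_of_singular_ode {q q₁ q₂ : ℝ → ℝ} {α b ν T : ℝ}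
    (hq : ContinuousOn q (Set.Icc 0 T)) (hq₁ : ContinuousOn q₁ (Set.Icc 0 T))
    (hderiv : ∀ t ∈ Set.Ioo 0 T, HasDerivAt q (q₁ t) t)
    (hderiv₁ : ∀ t ∈ Set.Ioo 0 T, HasDerivAt q₁ (q₂ t) t)
    (hode : ∀ t ∈ Set.Ioo 0 T, (1 + t) * (t * q₂ t + α * q₁ t) = b * t * q₁ t - ν * q t)
    (hα : 0 < α) (hb : 0 ≤ b) (hT0 : 0 < T) (hT : T ≤ 1) (hν : (1 + α) ^ 2 < ν * T) :
    ∃ t ∈ Set.Ioo 0 T, q t = 0 := by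
  -- The Wronskian of `q` with the strict supersolution `(T - t) ^ 2` vanishes at both ends.
  let W : ℝ → ℝ := fun t => sturmWeight α b t * (q t * (-2 * (T - t)) - (T - t) ^ 2 * q₁ t)
  have hW : ∀ t ∈ Set.Ioo 0 T, HasDerivAt W (sturmWeight α b t / (t * (1 + t)) *
      ((1 + t) * (2 * t - 2 * α * (T - t)) + 2 * b * t * (T - t) + ν * (T - t) ^ 2) * q t) t := by
    intro t ht
    have ht0 : t ≠ 0 := ht.1.ne'
    have ht1 : 1 + t ≠ 0 := by linarith [ht.1]
    have hq₂ : q₂ t = ((b * t * q₁ t - ν * q t) / (1 + t) - α * q₁ t) / t := by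
      rw [← hode t ht]
      field_simp
      ring
    have hlin : HasDerivAt (fun s => T - s) (-1) t := (hasDerivAt_id t).const_sub T
    refine ((hasDerivAt_sturmWeight α b ht.1).mul
      (((hderiv t ht).mul (hlin.const_mul (-2))).sub
        ((hlin.pow 2).mul (hderiv₁ t ht)))).congr_deriv ?_
    simp only [hq₂, Pi.sub_apply, Pi.mul_apply, Pi.pow_apply]
    field_simp
    ring
  have hcont : ContinuousOn W (Set.Icc 0 T) :=
    ((continuousOn_sturmWeight hα.le b).mono Set.Icc_subset_Ici_self).mul (by fun_prop)
  obtain ⟨t, ht, hzero⟩ := exists_hasDerivAt_eq_zero hT0 hcont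
    (by simp [W, sturmWeight_zero hα.ne']) hW
  have ht0 := ht.1
  have hfactor : 0 < sturmWeight α b t / (t * (1 + t)) :=
    div_pos (sturmWeight_pos α b ht0) (by positivity)
  exact ⟨t, ht, (mul_eq_zero.mp hzero).resolve_left
    (mul_pos hfactor (sturm_supersolution_pos hα hb hT hν ht)).ne'⟩

end Sturm

section ZonalProfile

/-- The coefficients of the zonal harmonic of degree `k` in `d + 1` variables, normalized to take
the value `1` at the pole: it is `∑ⱼ zonalCoeff d k j * x ^ (k - 2 j) * |y| ^ (2 j)`, and
harmonicity is the recursion. -/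
def zonalCoeff (d k : ℕ) : ℕ → ℝ
  | 0 => 1
  | j + 1 => -((k - 2 * j) * (k - 2 * j - 1)) / (2 * (j + 1) * (2 * j + d)) * zonalCoeff d k j

theorem zonalCoeff_succ {d : ℕ} (hd : d ≠ 0) (k j : ℕ) :
    2 * (j + 1) * (2 * j + d) * zonalCoeff d k (j + 1) =
      -((k - 2 * j) * (k - 2 * j - 1)) * zonalCoeff d k j := by
  have : (2 * j + d : ℝ) ≠ 0 := by positivity
  rw [zonalCoeff]
  field_simp

theorem zonalCoeff_eq_zero (d k : ℕ) : ∀ {j : ℕ}, k < 2 * j → zonalCoeff d k j = 0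
  | 0, h => by omega
  | j + 1, h => by
    rw [zonalCoeff]
    rcases lt_or_ge k (2 * j) with hlt | hle
    · rw [zonalCoeff_eq_zero d k hlt, mul_zero]
    · obtain rfl | rfl : k = 2 * j ∨ k = 2 * j + 1 := by omega
      all_goals simp

/-- The zonal harmonic of degree `k` in `d + 1` variables on the hyperplane `x = 1`, as a
polynomial in `t = |y| ^ 2`. -/
def zonalProfile (d k : ℕ) : Polynomial ℝ :=
  ∑ j ∈ Finset.range (k / 2 + 1), Polynomial.C (zonalCoeff d k j) * Polynomial.X ^ j

theorem coeff_zonalProfile (d k j : ℕ) : (zonalProfile d k).coeff j = zonalCoeff d k j := by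
  simp only [zonalProfile, Polynomial.finsetSum_coeff, Polynomial.coeff_C_mul_X_pow,
    Finset.sum_ite_eq, Finset.mem_range, ite_eq_left_iff]
  exact fun h => (zonalCoeff_eq_zero d k (by omega)).symm

theorem zonalProfile_ode {d : ℕ} (hd : d ≠ 0) (k : ℕ) :
    (1 + Polynomial.X) * (Polynomial.X * (zonalProfile d k).derivative.derivative +
        Polynomial.C (d / 2 : ℝ) * (zonalProfile d k).derivative) =
      Polynomial.C (k + d / 2 - 3 / 2 : ℝ) * (Polynomial.X * (zonalProfile d k).derivative) -
        Polynomial.C (k * (k - 1) / 4 : ℝ) * zonalProfile d k := by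
  ext j
  have hrec := zonalCoeff_succ hd k j
  rw [add_mul, one_mul]
  rcases j with _ | _ | j <;>
  · simp only [Polynomial.coeff_add, Polynomial.coeff_sub, Polynomial.coeff_C_mul,
      Polynomial.coeff_X_mul, Polynomial.coeff_X_mul_zero, coeff_zonalProfile,
      Polynomial.coeff_derivative, zero_add] at hrec ⊢
    push_cast at hrec ⊢
    linarith

theorem exists_root_zonalProfile {d k : ℕ} (hd : d ≠ 0) (hk : 2 * (d + 2) ≤ k) :
    ∃ t : ℝ, 0 < t ∧ t ≤ (2 * (d + 2) / k) ^ 2 ∧ (zonalProfile d k).eval t = 0 := by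
  have hk' : 2 * ((d : ℝ) + 2) ≤ k := by exact_mod_cast hk
  have hd' : (1 : ℝ) ≤ d := by exact_mod_cast Nat.one_le_iff_ne_zero.mpr hd
  have hk0 : (0 : ℝ) < k := by linarith
  obtain ⟨t, ht, hroot⟩ := exists_root_of_singular_ode (q := fun t => (zonalProfile d k).eval t)
    (q₁ := fun t => (zonalProfile d k).derivative.eval t) (α := d / 2) (b := k + d / 2 - 3 / 2)
    (ν := k * (k - 1) / 4) (T := (2 * (d + 2) / k) ^ 2)
    (zonalProfile d k).continuousOn (zonalProfile d k).derivative.continuousOn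
    (fun t _ => (zonalProfile d k).hasDerivAt t)
    (fun t _ => (zonalProfile d k).derivative.hasDerivAt t)
    (fun t _ => by simpa [mul_assoc] using congrArg (Polynomial.eval t) (zonalProfile_ode hd k))
    (by positivity) (by linarith) (by positivity)
    (pow_le_one₀ (by positivity) ((div_le_one hk0).mpr hk')) (by
      have hcalc : (k * (k - 1) / 4) * (2 * ((d : ℝ) + 2) / k) ^ 2 =
          (1 + d / 2) ^ 2 * (4 - 4 / k) := by
        field_simp
        ring
      have : 4 / (k : ℝ) < 3 := by
        rw [div_lt_iff₀ hk0]
        linarith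
      rw [hcalc]
      exact lt_mul_of_one_lt_right (by positivity) (by linarith))
  exact ⟨t, ht.1, ht.2.le, hroot⟩

end ZonalProfile

section ZonalHarmonic

open MvPolynomial

variable {σ : Type*}

/-- The homogeneous form `∑ⱼ cⱼ xᵢ ^ (k - 2j) |x_s| ^ (2j)` of degree `k`, where `|x_s|` is the
Euclidean norm of the coordinates in `s` and `cⱼ = zonalCoeff s.card k j`. When `i ∉ s` and `s` is
nonempty it is harmonic: it is the zonal harmonic about the `i`-th axis of the coordinate subspace
spanned by `i` and `s`. -/
def zonalHarmonic (i : σ) (s : Finset σ) (k : ℕ) : MvPolynomial σ ℝ :=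
  ∑ j ∈ Finset.range (k / 2 + 1), zonalCoeff s.card k j • (X i ^ (k - 2 * j) * sumSq s ^ j)

theorem isHomogeneous_zonalHarmonic (i : σ) (s : Finset σ) (k : ℕ) :
    (zonalHarmonic i s k).IsHomogeneous k := by
  refine IsHomogeneous.sum _ _ _ fun j hj => ?_
  have hjk : 2 * j ≤ k := by
    have := Finset.mem_range.mp hj
    omega
  rw [smul_eq_C_mul]
  convert (isHomogeneous_C σ (zonalCoeff s.card k j)).mul
    (((isHomogeneous_X ℝ i).pow (k - 2 * j)).mul ((isHomogeneous_sumSq s).pow j)) using 1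
  omega

theorem polyLaplacian_zonalHarmonic [Fintype σ] {i : σ} {s : Finset σ} (hi : i ∉ s)
    (hs : s.card ≠ 0) (k : ℕ) : polyLaplacian (zonalHarmonic i s k) = 0 := by
  let axial (j : ℕ) : MvPolynomial σ ℝ :=
    zonalCoeff s.card k j • (polyLaplacian (X i ^ (k - 2 * j)) * sumSq s ^ j)
  let radial (j : ℕ) : MvPolynomial σ ℝ :=
    zonalCoeff s.card k j • (X i ^ (k - 2 * j) * polyLaplacian (sumSq s ^ j))
  have hsplit : polyLaplacian (zonalHarmonic i s k) =
      ∑ j ∈ Finset.range (k / 2 + 1), axial j + ∑ j ∈ Finset.range (k / 2 + 1), radial j := by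
    simp only [zonalHarmonic, map_sum, map_smul, polyLaplacian_X_pow_mul_sumSq_pow hi, smul_add,
      Finset.sum_add_distrib, axial, radial]
  have haxial_last : axial (k / 2) = 0 := by
    have : k - 2 * (k / 2) = 0 ∨ k - 2 * (k / 2) = 1 := by omega
    rcases this with h | h <;> simp [axial, polyLaplacian_X_pow, h]
  have hradial_zero : radial 0 = 0 := by
    simp [radial, polyLaplacian_apply]
  have hcancel : ∀ j ∈ Finset.range (k / 2), axial j + radial (j + 1) = 0 := by
    intro j hj
    have hjk : 2 * j + 2 ≤ k := by
      have := Finset.mem_range.mp hj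
      omega
    have hrec := congrArg (C (σ := σ)) (zonalCoeff_succ hs k j)
    obtain ⟨m, rfl⟩ := Nat.exists_eq_add_of_le hjk
    have h₁ : 2 * j + 2 + m - 2 * j = m + 2 := by omega
    have h₂ : 2 * j + 2 + m - 2 * (j + 1) = m := by omega
    simp only [axial, radial, polyLaplacian_X_pow, polyLaplacian_sumSq_pow_succ, smul_eq_C_mul,
      h₁, h₂] at hrec ⊢
    push_cast [map_mul, map_add, map_sub, map_neg, map_natCast, map_ofNat, map_one] at hrec ⊢
    linear_combination X i ^ m * sumSq s ^ j * hrec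
  rw [hsplit, Finset.sum_range_succ, Finset.sum_range_succ', haxial_last, hradial_zero, add_zero,
    add_zero, ← Finset.sum_add_distrib, Finset.sum_eq_zero hcancel]

theorem polyFun_zonalHarmonic {i : σ} {s : Finset σ} {x : EuclideanSpace ℝ σ} {t : ℝ}
    (ht : ∑ l ∈ s, x l ^ 2 = t * x i ^ 2) (k : ℕ) :
    polyFun (zonalHarmonic i s k) x = x i ^ k * (zonalProfile s.card k).eval t := by
  simp only [polyFun, zonalHarmonic, zonalProfile, sumSq, Polynomial.eval_finsetSum, map_sum,
    Finset.mul_sum, smul_eval, map_mul, map_pow, eval_X, ht, Polynomial.eval_mul,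
    Polynomial.eval_C, Polynomial.eval_pow, Polynomial.eval_X]
  refine Finset.sum_congr rfl fun j hj => ?_
  have hpow : x i ^ k = x i ^ (k - 2 * j) * (x i ^ 2) ^ j := by
    rw [← pow_mul, ← pow_add, Nat.sub_add_cancel]
    have := Finset.mem_range.mp hj
    omega
  rw [hpow]
  ring

end ZonalHarmonic

section Angle

variable {E : Type*} [NormedAddCommGroup E] [InnerProductSpace ℝ E]

theorem angle_lt_of_norm_sq_le {p x : E} {R : ℝ} (hp : ‖p‖ = 1) (hx : x ≠ 0) (hR : 0 < R)
    (hpx : 0 ≤ inner ℝ p x) (h : ‖x‖ ^ 2 ≤ inner ℝ p x ^ 2 * (R ^ 2 + 1)) :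
    InnerProductGeometry.angle p x < R := by
  by_contra! hle
  have hcos := Real.cos_lt_one_div_sqrt_sq_add_one (x := InnerProductGeometry.angle p x)
    (by linarith [Real.pi_pos]) (by linarith [InnerProductGeometry.angle_le_pi p x, Real.pi_pos])
    (hR.trans_le hle).ne'
  rw [InnerProductGeometry.cos_angle, hp, one_mul,
    div_lt_div_iff₀ (norm_pos_iff.mpr hx) (by positivity), one_mul] at hcos
  refine hcos.not_ge (abs_le_of_sq_le_sq' (h.trans ?_) (by positivity)).2
  rw [mul_pow, Real.sq_sqrt (by positivity)]
  gcongr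

theorem one_sub_inner_sq_le_min_sq {p x : E} {R : ℝ} (hp : ‖p‖ = 1) (hx : ‖x‖ = 1)
    (h : InnerProductGeometry.angle p x < R) : 1 - inner ℝ p x ^ 2 ≤ min R 1 ^ 2 := by
  rw [InnerProductGeometry.inner_eq_cos_angle_of_norm_eq_one hp hx, ← Real.sin_sq]
  have hangle := InnerProductGeometry.angle_nonneg p x
  exact pow_le_pow_left₀ (InnerProductGeometry.sin_angle_nonneg p x)
    (le_min ((Real.sin_le hangle).trans h.le) (Real.sin_le_one _)) 2

end Angle

section Volume

open scoped Pointwise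

variable {n : ℕ}

theorem isOpen_geodesicBall (p : Sph n) (R : ℝ) : IsOpen (geodesicBall p R) := by
  refine isOpen_lt ?_ continuous_const
  simp only [InnerProductGeometry.angle, norm_coe]
  fun_prop

/-- The open solid cone over a set `s` in the sphere, with vertex the origin. The vertex is
removed. -/
def cone (s : Set (Sph n)) : Set (Ambient n) := Set.Ioo (0 : ℝ) 1 • (Subtype.val '' s)

theorem mem_cone {s : Set (Sph n)} {y : Ambient n} :
    y ∈ cone s ↔ ∃ r ∈ Set.Ioo (0 : ℝ) 1, ∃ x ∈ s, r • (x : Ambient n) = y := by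
  simp [cone, Set.mem_smul]

theorem mem_cone_of_proj_mem {s : Set (Sph n)} {y : Ambient n} (hy : y ≠ 0) (hy1 : ‖y‖ < 1)
    (h : proj y hy ∈ s) : y ∈ cone s :=
  mem_cone.mpr ⟨‖y‖, ⟨norm_pos_iff.mpr hy, hy1⟩, _, h, norm_smul_proj y hy⟩

theorem vol_div_vol {s t : Set (Sph n)} (hs : MeasurableSet s) (ht : MeasurableSet t) :
    vol n s / vol n t = volume (cone s) / volume (cone t) := by
  rw [vol, Measure.toSphere_apply' _ hs, Measure.toSphere_apply' _ ht, finrank_euclideanSpace_fin,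
    ENNReal.mul_div_mul_left _ _ (by positivity) (ENNReal.natCast_ne_top _), cone, cone]

/-- The coordinate indices of `ℝⁿ⁺¹` other than the first and the last. -/
def transverse (n : ℕ) : Finset (Fin (n + 1)) := {0, Fin.last n}ᶜ

theorem mem_transverse {i : Fin (n + 1)} : i ∈ transverse n ↔ i ≠ 0 ∧ i ≠ Fin.last n := by
  simp [transverse]

theorem forall_iff_forall_transverse {P : Fin (n + 1) → Prop} :
    (∀ i, P i) ↔ P 0 ∧ P (Fin.last n) ∧ ∀ i ∈ transverse n, P i := by
  refine ⟨fun h => ⟨h _, h _, fun i _ => h i⟩, fun ⟨hfirst, hlast, hother⟩ i => ?_⟩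
  by_cases hi : i ∈ transverse n
  · exact hother i hi
  · rcases not_and_or.mp (mt mem_transverse.mpr hi) with h | h
    · rwa [not_not.mp h]
    · rwa [not_not.mp h]

theorem zero_notMem_transverse : (0 : Fin (n + 1)) ∉ transverse n := by simp [transverse]

/-- The product set in `ℝⁿ⁺¹` whose first coordinate lies in `I`, whose last coordinate lies in
`J`, and whose other coordinates have absolute value less than `w`. -/
def box (I J : Set ℝ) (w : ℝ) : Set (Ambient n) :=
  {x | x 0 ∈ I ∧ x (Fin.last n) ∈ J ∧ ∀ i ∈ transverse n, |x i| < w}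

/-- The point of the sphere on the positive half of the last coordinate axis. -/
def pole (n : ℕ) : Sph n :=
  ⟨EuclideanSpace.single (Fin.last n) 1, by simp⟩

theorem inner_pole (x : Ambient n) : inner ℝ (pole n : Ambient n) x = x (Fin.last n) := by
  simp [pole, EuclideanSpace.inner_single_left]

/-- The solid sector around the first coordinate axis in which the slope of the transverse
coordinates with respect to the first one is less than `√t`. -/
def sector (n : ℕ) (t : ℝ) : Set (Sph n) :=
  {x | 0 < (x : Ambient n) 0 ∧
    ∑ i ∈ transverse n, (x : Ambient n) i ^ 2 < t * (x : Ambient n) 0 ^ 2}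

theorem isOpen_sector (t : ℝ) : IsOpen (sector n t) :=
  (isOpen_lt (f := fun _ : Sph n => (0 : ℝ)) (by fun_prop) (by fun_prop)).inter
    (isOpen_lt (f := fun x : Sph n => ∑ i ∈ transverse n, (x : Ambient n) i ^ 2)
      (by fun_prop) (by fun_prop))

variable [NeZero n]

theorem zero_ne_last : (0 : Fin (n + 1)) ≠ Fin.last n := Fin.last_pos'.ne

theorem card_transverse : (transverse n).card = n - 1 := by
  rw [transverse, Finset.card_compl, Finset.card_pair zero_ne_last, Fintype.card_fin]
  omega

@[to_additive]
theorem prod_univ_eq_prod_transverse {M : Type*} [CommMonoid M] (f : Fin (n + 1) → M) :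
    ∏ i, f i = f 0 * f (Fin.last n) * ∏ i ∈ transverse n, f i := by
  rw [← Finset.prod_pair zero_ne_last, transverse, Finset.prod_mul_prod_compl]

theorem norm_sq_eq_sum_transverse (x : Ambient n) :
    ‖x‖ ^ 2 = x 0 ^ 2 + x (Fin.last n) ^ 2 + ∑ i ∈ transverse n, x i ^ 2 := by
  rw [EuclideanSpace.real_norm_sq_eq, sum_univ_eq_sum_transverse]

theorem volume_box (I J : Set ℝ) (w : ℝ) :
    volume (box I J w : Set (Ambient n)) =
      volume I * volume J * ENNReal.ofReal (2 * w) ^ (n - 1) := by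
  let side (i : Fin (n + 1)) : Set ℝ :=
    if i = 0 then I else if i = Fin.last n then J else Set.Ioo (-w) w
  have hzero : side 0 = I := if_pos rfl
  have hlast : side (Fin.last n) = J := by simp [side, zero_ne_last.symm]
  have htransverse : ∀ i ∈ transverse n, side i = Set.Ioo (-w) w := fun i hi => by
    simp [side, mem_transverse.mp hi]
  have hbox : (box I J w : Set (Ambient n)) =
      (MeasurableEquiv.toLp 2 (Fin (n + 1) → ℝ)).symm ⁻¹' Set.univ.pi side := by
    ext x
    rw [Set.mem_preimage, Set.mem_univ_pi, forall_iff_forall_transverse, hzero, hlast]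
    refine and_congr Iff.rfl (and_congr Iff.rfl (forall₂_congr fun i hi => ?_))
    rw [htransverse i hi, abs_lt]
    rfl
  rw [hbox, (EuclideanSpace.volume_preserving_symm_measurableEquiv_toLp
    (Fin (n + 1))).measure_preimage_equiv, volume_pi_pi, prod_univ_eq_prod_transverse, hzero,
    hlast, Finset.prod_congr rfl fun i hi => by rw [htransverse i hi, Real.volume_Ioo],
    Finset.prod_const, card_transverse, sub_neg_eq_add, two_mul]

theorem box_subset_cone_geodesicBall {R : ℝ} (hR : 0 < R) (hR1 : R ≤ 1) :
    box (Set.Ioo (-(R / (4 * n))) (R / (4 * n))) (Set.Ioo (1 / 4) (1 / 2)) (R / (4 * n)) ⊆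
      cone (geodesicBall (pole n) R) := by
  rintro y ⟨hfirst, ⟨hlast, hlast'⟩, hother⟩
  have hn : (1 : ℝ) ≤ n := by exact_mod_cast NeZero.one_le
  have hfirst_sq : y 0 ^ 2 ≤ (R / (4 * n)) ^ 2 := sq_le_sq' hfirst.1.le hfirst.2.le
  have hother_sq : ∑ i ∈ transverse n, y i ^ 2 ≤ (n - 1) * (R / (4 * n)) ^ 2 := by
    have h := Finset.sum_le_card_nsmul (transverse n) (fun i => y i ^ 2) _
      fun i hi => sq_le_sq.mpr ((hother i hi).le.trans (le_abs_self _))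
    rwa [card_transverse, nsmul_eq_mul, Nat.cast_sub NeZero.one_le, Nat.cast_one] at h
  have hwidth : n * (R / (4 * n)) ^ 2 ≤ R ^ 2 / 16 :=
    calc n * (R / (4 * n)) ^ 2 = R ^ 2 / 16 / n := by field_simp; norm_num
      _ ≤ R ^ 2 / 16 := div_le_self (by positivity) hn
  have hnorm : ‖y‖ ^ 2 ≤ y (Fin.last n) ^ 2 + R ^ 2 / 16 := by
    rw [norm_sq_eq_sum_transverse]
    linarith
  have hy : y ≠ 0 := by
    rintro rfl
    norm_num at hlast
  refine mem_cone_of_proj_mem hy (lt_of_pow_lt_pow_left₀ 2 zero_le_one (by nlinarith)) ?_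
  rw [geodesicBall, Set.mem_ofPred_eq, coe_proj,
    InnerProductGeometry.angle_smul_right_of_pos _ _ (by positivity)]
  refine angle_lt_of_norm_sq_le (norm_coe _) hy hR ?_ ?_ <;> rw [inner_pole]
  · linarith
  · nlinarith [mul_nonneg (sq_nonneg R) (show 0 ≤ y (Fin.last n) ^ 2 - 1 / 16 by nlinarith)]

theorem cone_sector_inter_geodesicBall_subset_box {R t : ℝ} (hR : 0 < R) (ht : 0 < t) :
    cone (sector n t ∩ geodesicBall (pole n) R) ⊆
      box (Set.Ioo 0 (min R 1)) (Set.Ioo (-1) 1) (√t * min R 1) := by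
  intro y hy
  obtain ⟨r, ⟨hr0, hr1⟩, x, ⟨⟨hx0, hslope⟩, hxR⟩, rfl⟩ := mem_cone.mp hy
  have hmin : 0 < min R 1 := lt_min hR one_pos
  have hball := one_sub_inner_sq_le_min_sq (norm_coe _) (norm_coe x) hxR
  rw [inner_pole] at hball
  have hnorm := norm_sq_eq_sum_transverse (x : Ambient n)
  rw [norm_coe] at hnorm
  have hother_le : ∀ i ∈ transverse n,
      (x : Ambient n) i ^ 2 ≤ ∑ i ∈ transverse n, (x : Ambient n) i ^ 2 := fun i hi =>
    Finset.single_le_sum (f := fun i => (x : Ambient n) i ^ 2) (fun i _ => sq_nonneg _) hi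
  have hother_nonneg : 0 ≤ ∑ i ∈ transverse n, (x : Ambient n) i ^ 2 :=
    Finset.sum_nonneg fun i _ => sq_nonneg _
  have hfirst : (x : Ambient n) 0 ≤ min R 1 :=
    le_of_sq_le_sq (by linarith) hmin.le
  have hlast : |(x : Ambient n) (Fin.last n)| ≤ 1 := by
    rw [← sq_le_one_iff_abs_le_one]
    nlinarith
  have hother : ∀ i ∈ transverse n, |(x : Ambient n) i| ≤ √t * min R 1 := fun i hi => by
    refine abs_le_of_sq_le_sq ?_ (by positivity)
    rw [mul_pow, Real.sq_sqrt ht.le]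
    exact (hother_le i hi).trans (hslope.le.trans (by gcongr))
  have hshrink : ∀ {a b : ℝ}, 0 < b → |a| ≤ b → |r * a| < b := fun hb hab => by
    rw [abs_mul, abs_of_pos hr0]
    nlinarith
  exact ⟨⟨mul_pos hr0 hx0, (abs_lt.mp (hshrink hmin ((abs_of_pos hx0).trans_le hfirst))).2⟩,
    abs_lt.mp (hshrink one_pos hlast), fun i hi => hshrink (by positivity) (hother i hi)⟩

theorem volume_cone_sector_inter_geodesicBall_le {R t : ℝ} (hR : 0 < R) (ht : 0 < t) :
    volume (cone (sector n t ∩ geodesicBall (pole n) R)) ≤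
      ENNReal.ofReal (2 * min R 1 * (2 * √t * min R 1) ^ (n - 1)) := by
  have hr : 0 < min R 1 := lt_min hR one_pos
  refine (measure_mono (cone_sector_inter_geodesicBall_subset_box hR ht)).trans_eq ?_
  generalize min R 1 = r at hr
  rw [volume_box, Real.volume_Ioo, Real.volume_Ioo, ← ENNReal.ofReal_pow (by positivity),
    sub_zero, ← ENNReal.ofReal_mul hr.le, ← ENNReal.ofReal_mul (by norm_num; positivity)]
  congr 1
  ring

theorem le_volume_cone_geodesicBall {R : ℝ} (hR : 0 < R) :
    ENNReal.ofReal (min R 1 / (8 * n) * (min R 1 / (2 * n)) ^ (n - 1)) ≤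
      volume (cone (geodesicBall (pole n) R)) := by
  have hr : 0 < min R 1 := lt_min hR one_pos
  have hball : geodesicBall (pole n) (min R 1) ⊆ geodesicBall (pole n) R := fun x hx =>
    lt_of_lt_of_le hx (min_le_left R 1)
  refine le_of_eq_of_le ?_ (measure_mono ((box_subset_cone_geodesicBall hr
    (min_le_right R 1)).trans (Set.smul_subset_smul_left (Set.image_mono hball))))
  generalize min R 1 = r at hr
  rw [volume_box, Real.volume_Ioo, Real.volume_Ioo, ← ENNReal.ofReal_pow (by positivity),
    sub_neg_eq_add, ← ENNReal.ofReal_mul (by positivity), ← ENNReal.ofReal_mul (by positivity)]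
  congr 2
  · ring
  · congr 1
    ring

theorem vol_sector_inter_geodesicBall_div_le {R t : ℝ} (hR : 0 < R) (ht : 0 < t) :
    vol n (sector n t ∩ geodesicBall (pole n) R) / vol n (geodesicBall (pole n) R) ≤
      ENNReal.ofReal (16 * n * (4 * n * √t) ^ (n - 1)) := by
  have hn : (0 : ℝ) < n := by exact_mod_cast NeZero.pos n
  rw [vol_div_vol ((isOpen_sector t).inter (isOpen_geodesicBall _ _)).measurableSet
    (isOpen_geodesicBall _ _).measurableSet]
  refine (ENNReal.div_le_div (volume_cone_sector_inter_geodesicBall_le hR ht)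
    (le_volume_cone_geodesicBall hR)).trans_eq ?_
  rw [← ENNReal.ofReal_div_of_pos (by positivity), mul_div_mul_comm, ← div_pow]
  congr 3 <;> field_simp <;> norm_num

end Volume

section ThinNodalDomain

variable {n : ℕ}

/-- The point of the sphere at angle `θ` from the pole in the direction of the first coordinate
axis. -/
def meridian (n : ℕ) [NeZero n] (θ : ℝ) : Sph n :=
  ⟨Real.sin θ • EuclideanSpace.single 0 1 + Real.cos θ • EuclideanSpace.single (Fin.last n) 1, by
    rw [mem_sphere_zero_iff_norm, ← sq_eq_sq₀ (norm_nonneg _) zero_le_one,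
      norm_sq_eq_sum_transverse, Finset.sum_eq_zero]
    · simp [zero_ne_last.symm]
    · intro i hi
      simp [mem_transverse.mp hi]⟩

section Meridian

variable [NeZero n]

theorem meridian_apply_zero (θ : ℝ) : (meridian n θ : Ambient n) 0 = Real.sin θ := by
  simp [meridian, NeZero.ne n]

theorem sum_transverse_meridian (θ : ℝ) :
    ∑ i ∈ transverse n, (meridian n θ : Ambient n) i ^ 2 = 0 :=
  Finset.sum_eq_zero fun i hi => by simp [meridian, mem_transverse.mp hi]

theorem angle_pole_meridian {θ : ℝ} (h0 : 0 ≤ θ) (hpi : θ ≤ Real.pi) :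
    InnerProductGeometry.angle (pole n : Ambient n) (meridian n θ) = θ := by
  rw [InnerProductGeometry.angle, norm_coe, norm_coe, inner_pole]
  simp [meridian, zero_ne_last.symm, Real.arccos_cos h0 hpi]

theorem meridian_mem_sector {θ t : ℝ} (hθ : 0 < Real.sin θ) (ht : 0 < t) :
    meridian n θ ∈ sector n t := by
  refine ⟨by rwa [meridian_apply_zero], ?_⟩
  rw [sum_transverse_meridian, meridian_apply_zero]
  positivity

theorem polyFun_zonalHarmonic_meridian (k : ℕ) (θ : ℝ) :
    polyFun (zonalHarmonic 0 (transverse n) k) (meridian n θ) = Real.sin θ ^ k := by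
  rw [polyFun_zonalHarmonic (t := 0) (by rw [sum_transverse_meridian, zero_mul]),
    ← Polynomial.coeff_zero_eq_eval_zero, coeff_zonalProfile, zonalCoeff, mul_one,
    meridian_apply_zero]

theorem isEigenfunction_zonalHarmonic (hn : 2 ≤ n) (k : ℕ) :
    IsEigenfunction n (k * (k + n - 1))
      fun p => polyFun (zonalHarmonic 0 (transverse n) k) p where
  smooth := contMDiff_polyFun _
  ne_zero h := by
    have hpole := congrFun h (meridian n (Real.pi / 2))
    simp [polyFun_zonalHarmonic_meridian] at hpole
  eigen p := by
    have hcard : (transverse n).card ≠ 0 := by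
      rw [card_transverse]
      omega
    rw [laplaceBeltrami_polyFun (isHomogeneous_zonalHarmonic 0 _ k),
      polyLaplacian_zonalHarmonic zero_notMem_transverse hcard]
    simp [polyFun]

end Meridian

theorem connectedComponentIn_subset_sector {k : ℕ} {t : ℝ}
    (hroot : (zonalProfile (transverse n).card k).eval t = 0) {x : Sph n} (hx : x ∈ sector n t) :
    connectedComponentIn {y : Sph n | polyFun (zonalHarmonic 0 (transverse n) k) y ≠ 0} x ⊆
      sector n t := by
  by_cases hne : polyFun (zonalHarmonic 0 (transverse n) k) x ≠ 0
  swap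
  · rw [connectedComponentIn_eq_empty hne]
    exact Set.empty_subset _
  have hcont : Continuous fun y : Sph n => ∑ i ∈ transverse n, (y : Ambient n) i ^ 2 := by
    fun_prop
  refine IsPreconnected.subset_left_of_subset_union (isOpen_sector t)
    (v := {y : Sph n | (y : Ambient n) 0 < 0} ∪
      {y : Sph n | t * (y : Ambient n) 0 ^ 2 < ∑ i ∈ transverse n, (y : Ambient n) i ^ 2})
    ((isOpen_lt (by fun_prop) (by fun_prop)).union (isOpen_lt (by fun_prop) hcont))
    ?_ ?_ ⟨x, mem_connectedComponentIn hne, hx⟩ isPreconnected_connectedComponentIn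
  · rw [Set.disjoint_left]
    rintro y ⟨hpos, hlt⟩ (hneg | hgt)
    · exact lt_asymm hpos hneg
    · exact lt_asymm hlt hgt
  · intro y hy
    have hy' : polyFun (zonalHarmonic 0 (transverse n) k) y ≠ 0 :=
      connectedComponentIn_subset _ _ hy
    rcases lt_trichotomy (∑ i ∈ transverse n, (y : Ambient n) i ^ 2) (t * (y : Ambient n) 0 ^ 2)
      with hlt | heq | hgt
    · have hy₀ : (y : Ambient n) 0 ≠ 0 := by
        intro h
        rw [h, zero_pow two_ne_zero, mul_zero] at hlt
        exact hlt.not_ge (Finset.sum_nonneg fun i _ => sq_nonneg _)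
      exact hy₀.lt_or_gt.elim (fun hneg => Or.inr (Or.inl hneg)) fun hpos => Or.inl ⟨hpos, hlt⟩
    · exact absurd (by rw [polyFun_zonalHarmonic heq, hroot, mul_zero]) hy'
    · exact Or.inr (Or.inr hgt)

/-- In a ball of radius `R` some eigenfunction with eigenvalue `lam` has a nodal domain which
meets the concentric ball of radius `R / 2` but occupies at most the proportion `ε` of the
volume. -/
def HasThinNodalDomain (n : ℕ) (lam R : ℝ) (ε : ENNReal) : Prop :=
  ∃ φ : Sph n → ℝ, IsEigenfunction n lam φ ∧ ∃ A : Set (Sph n), IsNodalDomain φ A ∧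
    ∃ p : Sph n, (A ∩ geodesicBall p (R / 2)).Nonempty ∧
      vol n (A ∩ geodesicBall p R) / vol n (geodesicBall p R) ≤ ε

theorem HasThinNodalDomain.mono {lam R : ℝ} {ε ε' : ENNReal} (h : HasThinNodalDomain n lam R ε)
    (hε : ε ≤ ε') : HasThinNodalDomain n lam R ε' := by
  obtain ⟨φ, hφ, A, hA, p, hne, hvol⟩ := h
  exact ⟨φ, hφ, A, hA, p, hne, hvol.trans hε⟩

theorem hasThinNodalDomain_one {lam R : ℝ} (h : IsEigenvalue n lam) (hR : 0 < R) :
    HasThinNodalDomain n lam R 1 := by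
  obtain ⟨φ, hφ⟩ := h
  obtain ⟨x, hx⟩ := Function.ne_iff.mp hφ.ne_zero
  refine ⟨φ, hφ, _, ⟨x, hx, rfl⟩, x, ⟨x, mem_connectedComponentIn hx, ?_⟩, ?_⟩
  · rw [geodesicBall, Set.mem_ofPred_eq, InnerProductGeometry.angle_self (coe_ne_zero x)]
    positivity
  · exact (ENNReal.div_le_div_right (measure_mono Set.inter_subset_right) _).trans
      ENNReal.div_self_le_one

theorem hasThinNodalDomain_of_root [NeZero n] (hn : 2 ≤ n) {k : ℕ} {t R : ℝ} (ht : 0 < t)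
    (hR : 0 < R) (hroot : (zonalProfile (transverse n).card k).eval t = 0) :
    HasThinNodalDomain n (k * (k + n - 1)) R
      (ENNReal.ofReal (16 * n * (4 * n * √t) ^ (n - 1))) := by
  set θ := min R 1 / 4
  have hθ : 0 < θ := by positivity
  have hθR : θ < R / 2 := by
    linarith [min_le_left R 1, show θ = min R 1 / 4 from rfl]
  have hθpi : θ < Real.pi := by
    linarith [min_le_right R 1, Real.pi_gt_three, show θ = min R 1 / 4 from rfl]
  have hsin : 0 < Real.sin θ := Real.sin_pos_of_pos_of_lt_pi hθ hθpi
  have hne : polyFun (zonalHarmonic 0 (transverse n) k) (meridian n θ) ≠ 0 := by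
    rw [polyFun_zonalHarmonic_meridian]
    positivity
  have hthin := connectedComponentIn_subset_sector hroot (meridian_mem_sector hsin ht)
  refine ⟨_, isEigenfunction_zonalHarmonic hn k, _, ⟨meridian n θ, hne, rfl⟩, pole n,
    ⟨meridian n θ, mem_connectedComponentIn hne, ?_⟩, ?_⟩
  · rwa [geodesicBall, Set.mem_ofPred_eq, angle_pole_meridian hθ.le hθpi.le]
  · exact (ENNReal.div_le_div_right (measure_mono (Set.inter_subset_inter_left _ hthin)) _).trans
      (vol_sector_inter_geodesicBall_div_le hR ht)

theorem hasThinNodalDomain_of_le_degree (hn : 2 ≤ n) {k : ℕ} (hk : 2 * (n + 1) ≤ k) {R : ℝ}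
    (hR : 0 < R) :
    HasThinNodalDomain n (k * (k + n - 1)) R
      (ENNReal.ofReal (16 * n * (8 * n * (n + 1) / k) ^ (n - 1))) := by
  have : NeZero n := ⟨by omega⟩
  obtain ⟨t, ht, htk, hroot⟩ := exists_root_zonalProfile (d := (transverse n).card) (k := k)
    (by rw [card_transverse]; omega) (by rw [card_transverse]; omega)
  have hsqrt : √t ≤ 2 * (n + 1) / k := by
    refine Real.sqrt_le_iff.mpr ⟨by positivity, htk.trans_eq ?_⟩
    rw [card_transverse, Nat.cast_sub (by omega), Nat.cast_one]
    ring
  refine (hasThinNodalDomain_of_root hn ht hR hroot).mono (ENNReal.ofReal_le_ofReal ?_)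
  have : 4 * n * √t ≤ 8 * n * (n + 1) / k :=
    calc 4 * n * √t ≤ 4 * n * (2 * (n + 1) / k) := by gcongr
      _ = 8 * n * (n + 1) / k := by ring
  gcongr

theorem ofReal_le_ofReal_div_ofReal_pow {a s c : ℝ} {m : ℕ} (hs : 0 ≤ s) (hc : 0 < c)
    (h : a * s ^ m ≤ c) : ENNReal.ofReal a ≤ ENNReal.ofReal c / ENNReal.ofReal s ^ m := by
  rw [← ENNReal.ofReal_pow hs,
    ENNReal.le_div_iff_mul_le (Or.inr (by simpa using hc)) (Or.inl ENNReal.ofReal_ne_top),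
    ← ENNReal.ofReal_mul' (by positivity)]
  exact ENNReal.ofReal_le_ofReal h

theorem sqrt_eigenvalue_le_of_degree_lt {k : ℕ} (hk : k < 2 * (n + 1)) :
    √(k * (k + n - 1) : ℝ) ≤ 3 * (n + 1) := by
  have hk' : (k : ℝ) ≤ 2 * n + 1 := by exact_mod_cast Nat.lt_succ_iff.mp hk
  refine Real.sqrt_le_iff.mpr ⟨by positivity, ?_⟩
  nlinarith [mul_nonneg (Nat.cast_nonneg k : (0 : ℝ) ≤ k) (sub_nonneg.mpr hk'),
    (Nat.cast_nonneg n : (0 : ℝ) ≤ n)]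

theorem sqrt_eigenvalue_le_of_le_degree {k : ℕ} (hk : n ≤ k) :
    √(k * (k + n - 1) : ℝ) ≤ 3 / 2 * k := by
  have hk' : (n : ℝ) ≤ k := by exact_mod_cast hk
  refine Real.sqrt_le_iff.mpr ⟨by positivity, ?_⟩
  nlinarith [(Nat.cast_nonneg k : (0 : ℝ) ≤ k)]

theorem hasThinNodalDomain_of_isEigenvalue (hn : 1 ≤ n) {lam R : ℝ} (h : IsEigenvalue n lam)
    (hR : 0 < R) :
    HasThinNodalDomain n lam R
      (ENNReal.ofReal (16 * n * (12 * n * (n + 1)) ^ (n - 1)) / ENNReal.ofReal √lam ^ (n - 1)) := by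
  have hn' : (1 : ℝ) ≤ n := by exact_mod_cast hn
  obtain ⟨k, rfl⟩ := exists_degree_of_isEigenvalue h
  by_cases hlarge : 2 ≤ n ∧ 2 * (n + 1) ≤ k
  · have hk : (0 : ℝ) < k := by exact_mod_cast (by omega : 0 < k)
    refine (hasThinNodalDomain_of_le_degree hlarge.1 hlarge.2 hR).mono
      (ofReal_le_ofReal_div_ofReal_pow (Real.sqrt_nonneg _) (by positivity) ?_)
    have hsqrt : √(k * (k + n - 1) : ℝ) ≤ 3 / 2 * k := sqrt_eigenvalue_le_of_le_degree (by omega)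
    calc 16 * n * (8 * n * (n + 1) / k) ^ (n - 1) * √(k * (k + n - 1) : ℝ) ^ (n - 1)
        ≤ 16 * n * (8 * n * (n + 1) / k) ^ (n - 1) * (3 / 2 * k : ℝ) ^ (n - 1) := by gcongr
      _ = 16 * n * (12 * n * (n + 1)) ^ (n - 1) := by
          rw [mul_assoc, ← mul_pow]
          congr 2
          field_simp
          norm_num
  · have hsqrt : √(k * (k + n - 1) : ℝ) ^ (n - 1) ≤ (12 * n * (n + 1)) ^ (n - 1) := by
      rcases not_and_or.mp hlarge with hlow | hlow
      · simp [show n - 1 = 0 by omega]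
      · gcongr
        exact (sqrt_eigenvalue_le_of_degree_lt (not_le.mp hlow)).trans (by nlinarith)
    refine (hasThinNodalDomain_one h hR).mono (ENNReal.ofReal_one.symm.trans_le
      (ofReal_le_ofReal_div_ofReal_pow (Real.sqrt_nonneg _) (by positivity) ?_))
    rw [one_mul]
    exact hsqrt.trans (le_mul_of_one_le_left (by positivity) (by linarith))

end ThinNodalDomain

end RoundSphere

end

theorem mainTheorem9_general (n : ℕ) (hn : 1 ≤ n) :
    ∃ C : ℝ, 0 < C ∧
      ∀ lam : ℝ, RoundSphere.IsEigenvalue n lam →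
      ∀ R : ℝ, 0 < R →
        ∃ φ : RoundSphere.Sph n → ℝ, RoundSphere.IsEigenfunction n lam φ ∧
        ∃ A : Set (RoundSphere.Sph n), RoundSphere.IsNodalDomain φ A ∧
        ∃ p : RoundSphere.Sph n,
          (A ∩ RoundSphere.geodesicBall p (R / 2)).Nonempty ∧
          RoundSphere.vol n (A ∩ RoundSphere.geodesicBall p R) /
              RoundSphere.vol n (RoundSphere.geodesicBall p R) ≤
            ENNReal.ofReal C / ENNReal.ofReal (Real.sqrt lam) ^ (n - 1) :=
  ⟨16 * n * (12 * n * (n + 1)) ^ (n - 1), by positivity,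
    fun _ hlam _ hR => RoundSphere.hasThinNodalDomain_of_isEigenvalue hn hlam hR⟩

theorem mainTheorem9 (n : ℕ) (hn : 1 ≤ n) :
    ∃ C : ℝ, 0 < C ∧
      ∀ lam : ℝ, RoundSphere.IsEigenvalue n lam →
      ∀ R : ℝ, 0 < R → R * Real.sqrt lam < 1 →
        ∃ φ : RoundSphere.Sph n → ℝ, RoundSphere.IsEigenfunction n lam φ ∧
        ∃ A : Set (RoundSphere.Sph n), RoundSphere.IsNodalDomain φ A ∧
        ∃ p : RoundSphere.Sph n,
          (A ∩ RoundSphere.geodesicBall p (R / 2)).Nonempty ∧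
          RoundSphere.vol n (A ∩ RoundSphere.geodesicBall p R) /
              RoundSphere.vol n (RoundSphere.geodesicBall p R) ≤
            ENNReal.ofReal C / ENNReal.ofReal (Real.sqrt lam) ^ (n - 1) := by
  obtain ⟨C, hC, hthin⟩ := mainTheorem9_general n hn
  exact ⟨C, hC, fun lam hlam R hR _ => hthin lam hlam R hR⟩
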